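/- Let $N\ge 2$ and $k>0$, write $\langle x\rangle=(1+|x|^2)^{1/2}$ for $x\in\mathbb R^N$, and let $L^\infty(\mathbb R^N)$ be the Banach space of (classes of) essentially bounded measurable functions $\mathbb R^N\to\mathbb C$, regarded as a real Banach space. Let $$\Phi_k(x)=\frac{i}{4}\Bigl(\frac{k}{2\pi|x|}\Bigr)^{\frac{N-2}{2}}H^{(1)}_{\frac{N-2}{2}}(k|x|),\qquad x\in\mathbb R^N\setminus\{0\},$$ where $H^{(1)}_\nu$ is the Hankel function of the first kind of order $\nu$, let $\mathcal R_k h=\Phi_k*h$, and let $N_f(u)(x)=f(x,u(x))$. Let $\alpha>\frac{N+1}{2}$ and let $f:\mathbb R^N\times\mathbb C\to\mathbb C$ be continuous with $$\sup_{|u|\le M,\;x\in\mathbb R^N}\langle x\rangle^{\alpha}|f(x,u)|<\infty\qquad\text{for all }M>0.$$ Suppose that $f(x,\cdot):\mathbb C\to\mathbb C$ is real differentiable for every $x\in\mathbb R^N$, and that $f'=\partial_uf:\mathbb R^N\times\mathbb C\to\mathcal L_{\mathbb R}(\mathbb C,\mathbb C)$ is continuous with $$\sup_{|u|\le M,\;x\in\mathbb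 R^N}\langle x\rangle^{\alpha}\|f'(x,u)\|_{\mathcal L_{\mathbb R}(\mathbb C,\mathbb C)}<\infty\qquad\text{for all }M>0.$$ Finally, suppose that $f(x,0)=0$ and $f'(x,0)=0$ for all $x\in\mathbb R^N$. Then $\mathcal R_kN_f(u)$ is well defined (the convolution integral converges absolutely at every point) and belongs to $L^\infty(\mathbb R^N)$ for every $u\in L^\infty(\mathbb R^N)$, and there exist open neighborhoods $U,V\subset L^\infty(\mathbb R^N)$ of zero such that for every $\varphi\in V$ there is a unique $u=u_\varphi\in U$ with $$u=\mathcal R_k(N_f(u))+\varphi\qquad\text{in }L^\infty(\mathbb R^N).$$ Moreover, the map $V\to U$, $\varphi\mapsto u_\varphi$, is of class $C^1$ (in the real sense). -/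

import Mathlib

/-- The Hankel function of the first kind `H^{(1)}_ν(z)`, for real order `ν > -1/2` and real argument
`z > 0`, through Hankel's integral
`H^{(1)}_ν(z) = √(2/(πz)) e^{i(z - νπ/2 - π/4)} / Γ(ν+1/2) ∫_0^∞ e^{-t} t^{ν-1/2} (1 + it/(2z))^{ν-1/2} dt`.
The theorem `isHankelH1_iff` below shows that this is the Hankel function. -/
noncomputable def hankelH1 (ν z : ℝ) : ℂ :=
  ((√(2 / (Real.pi * z)) : ℝ) : ℂ)
    * Complex.exp (Complex.I * ((z - ν * Real.pi / 2 - Real.pi / 4 : ℝ) : ℂ))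
    / ((Real.Gamma (ν + 1 / 2) : ℝ) : ℂ)
    * ∫ t in Set.Ioi (0 : ℝ), ((Real.exp (-t) * t ^ (ν - 1 / 2) : ℝ) : ℂ)
        * (1 + Complex.I * ((t / (2 * z) : ℝ) : ℂ)) ^ ((ν - 1 / 2 : ℝ) : ℂ)

/-- The defining property of `H^{(1)}_ν` on the positive half-line: it solves Bessel's differential
equation of order `ν` and is asymptotic to `√(2/(πz)) e^{i(z - νπ/2 - π/4)}` at infinity. -/
structure IsHankelH1 (ν : ℝ) (H : ℝ → ℂ) : Prop where
  bessel : ∃ H' H'' : ℝ → ℂ, ∀ z : ℝ, 0 < z → HasDerivAt H (H' z) z ∧ HasDerivAt H' (H'' z) z ∧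
    (z : ℂ) ^ 2 * H'' z + (z : ℂ) * H' z + ((z : ℂ) ^ 2 - (ν : ℂ) ^ 2) * H z = 0
  asymptotic : Asymptotics.IsEquivalent Filter.atTop H fun z : ℝ =>
    ((√(2 / (Real.pi * z)) : ℝ) : ℂ)
      * Complex.exp (Complex.I * ((z - ν * Real.pi / 2 - Real.pi / 4 : ℝ) : ℂ))

section HankelFacts

open MeasureTheory Set Filter Topology

theorem hankel_base_bound (r : ℝ) {s t : ℝ} (ht : 0 ≤ t) (hts : t ≤ s) :
    ‖(1 + Complex.I * (t : ℂ)) ^ (r : ℂ)‖ ≤ (1 + s) ^ (|r| + 1) := by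
  rw [Complex.norm_cpow_real]
  have h1 : 1 ≤ ‖1 + Complex.I * (t : ℂ)‖ := by
    have := Complex.re_le_norm (1 + Complex.I * (t : ℂ))
    simpa using this
  have h2 : ‖1 + Complex.I * (t : ℂ)‖ ≤ 1 + s := by
    refine (norm_add_le _ _).trans ?_
    simp [abs_of_nonneg ht, hts]
  calc _ ≤ ‖1 + Complex.I * (t : ℂ)‖ ^ (|r| + 1) :=
        Real.rpow_le_rpow_of_exponent_le h1 (by linarith [le_abs_self r])
    _ ≤ _ := Real.rpow_le_rpow (norm_nonneg _) h2 (by positivity)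

theorem hankel_pow_le_exp (q ε : ℝ) (hq : 0 < q) (hε : 0 < ε) :
    ∃ C : ℝ, 0 ≤ C ∧ ∀ s : ℝ, 0 ≤ s → (1 + s) ^ q ≤ C * Real.exp (ε * s) := by
  refine ⟨(1 + q / ε) ^ q, by positivity, fun s hs => ?_⟩
  have h1 : 1 + s ≤ (1 + q / ε) * Real.exp (ε / q * s) := by
    have h2 := Real.add_one_le_exp (ε / q * s)
    have h3 : (1 + q / ε) * (ε / q * s + 1) ≤ (1 + q / ε) * Real.exp (ε / q * s) := by gcongr
    have h4 : (1 + q / ε) * (ε / q * s + 1) = 1 + s + (ε / q * s + q / ε) := by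
      field_simp; ring
    have : 0 ≤ ε / q * s + q / ε := by positivity
    linarith
  calc (1 + s) ^ q ≤ ((1 + q / ε) * Real.exp (ε / q * s)) ^ q :=
        Real.rpow_le_rpow (by positivity) h1 hq.le
    _ = _ := by
        rw [Real.mul_rpow (by positivity) (by positivity), ← Real.exp_mul]
        congr 2
        field_simp

/-- The function `s^(μ+m) e^{-zs} (1+is/2)^μ`. -/
noncomputable def hankelKernel (μ : ℝ) (m : ℕ) (z s : ℝ) : ℂ :=
  (s : ℂ) ^ m * (((Real.exp (-(z * s)) * s ^ μ : ℝ) : ℂ)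
    * (1 + Complex.I * ((s / 2 : ℝ) : ℂ)) ^ (μ : ℂ))

theorem hankel_slit (t : ℝ) : 1 + Complex.I * (t : ℂ) ∈ Complex.slitPlane := by
  left; simp

theorem hankelKernel_meas (μ : ℝ) (m : ℕ) (z : ℝ) :
    AEStronglyMeasurable (hankelKernel μ m z) (volume.restrict (Ioi 0)) := by
  unfold hankelKernel
  have : Measurable fun s : ℝ => (1 + Complex.I * ((s / 2 : ℝ) : ℂ)) ^ (μ : ℂ) := by fun_prop
  have h2 : Measurable fun s : ℝ => s ^ μ := by fun_prop
  exact (by fun_prop : Measurable _).aestronglyMeasurable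

/-- An integrable majorant. -/
noncomputable def hankelMaj (μ : ℝ) (m : ℕ) (z s : ℝ) : ℝ :=
  s ^ m * (Real.exp (-(z * s)) * s ^ μ * (1 + s) ^ (|μ| + 1))

theorem hankelKernel_le (μ : ℝ) (m : ℕ) {z z' s : ℝ} (hs : 0 < s) (hz : z' ≤ z) :
    ‖hankelKernel μ m z s‖ ≤ hankelMaj μ m z' s := by
  unfold hankelKernel hankelMaj
  rw [norm_mul, norm_mul, norm_pow, Complex.norm_real, Complex.norm_real, Real.norm_of_nonneg hs.le,
    Real.norm_of_nonneg (by positivity)]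
  gcongr
  exact hankel_base_bound μ (by positivity) (by linarith)

theorem hankelMaj_integrable {μ : ℝ} (hμ : -1 < μ) (m : ℕ) {z : ℝ} (hz : 0 < z) :
    IntegrableOn (hankelMaj μ m z) (Ioi 0) := by
  obtain ⟨C, hC, h⟩ := hankel_pow_le_exp (|μ| + 1) (z / 2) (by positivity) (by positivity)
  have h1 := (integrableOn_rpow_mul_exp_neg_mul_rpow (p := 1) (s := μ + m) (b := z / 2)
    (by have : (0 : ℝ) ≤ m := by positivity
        linarith) one_pos (by positivity)).const_mul C
  refine Integrable.mono' h1 ?_ ?_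
  · unfold hankelMaj
    have h2 : Measurable fun s : ℝ => s ^ μ := by fun_prop
    have h3 : Measurable fun s : ℝ => (1 + s) ^ (|μ| + 1) := by fun_prop
    exact (by fun_prop : Measurable _).aestronglyMeasurable
  · refine (ae_restrict_iff' measurableSet_Ioi).2 (Eventually.of_forall fun s hs => ?_)
    have hs : 0 < s := hs
    rw [Real.norm_of_nonneg (by unfold hankelMaj; positivity)]
    unfold hankelMaj
    calc _ ≤ s ^ m * (Real.exp (-(z * s)) * s ^ μ * (C * Real.exp (z / 2 * s))) := by
          gcongr; exact h s hs.le
      _ = C * (s ^ (μ + m) * Real.exp (-(z / 2) * s ^ (1 : ℝ))) := by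
          rw [Real.rpow_add hs, Real.rpow_natCast, Real.rpow_one]
          have : Real.exp (-(z / 2) * s) = Real.exp (-(z * s)) * Real.exp (z / 2 * s) := by
            rw [← Real.exp_add]; ring_nf
          rw [this]; ring

theorem hankelKernel_integrable {μ : ℝ} (hμ : -1 < μ) (m : ℕ) {z : ℝ} (hz : 0 < z) :
    IntegrableOn (hankelKernel μ m z) (Ioi 0) :=
  Integrable.mono' (hankelMaj_integrable hμ m hz) (hankelKernel_meas μ m z)
    ((ae_restrict_iff' measurableSet_Ioi).2
      (Eventually.of_forall fun _ hs => hankelKernel_le μ m hs le_rfl))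

/-- The integral of `hankelKernel` over the half-line. -/
noncomputable def hankelL (μ : ℝ) (m : ℕ) (z : ℝ) : ℂ := ∫ s in Ioi (0 : ℝ), hankelKernel μ m z s

theorem hankelL_hasDerivAt {μ : ℝ} (hμ : -1 < μ) (m : ℕ) {z : ℝ} (hz : 0 < z) :
    HasDerivAt (hankelL μ m) (-hankelL μ (m + 1) z) z := by
  have := (hasDerivAt_integral_of_dominated_loc_of_deriv_le (μ := volume.restrict (Ioi (0 : ℝ)))
    (F := fun z s => hankelKernel μ m z s) (F' := fun z s => -hankelKernel μ (m + 1) z s)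
    (x₀ := z) (s := Ioi (z / 2)) (bound := hankelMaj μ (m + 1) (z / 2))
    (Ioi_mem_nhds (by linarith)) (Eventually.of_forall fun z => hankelKernel_meas μ m z)
    (hankelKernel_integrable hμ m hz) (hankelKernel_meas μ (m + 1) z).neg
    ((ae_restrict_iff' measurableSet_Ioi).2
      (Eventually.of_forall fun s hs x hx => by
        rw [norm_neg]; exact hankelKernel_le μ (m + 1) hs (le_of_lt hx)))
    (hankelMaj_integrable hμ (m + 1) (by positivity))
    (Eventually.of_forall fun s x _ => by
      unfold hankelKernel
      have h1 : HasDerivAt (fun x : ℝ => Real.exp (-(x * s)) * s ^ μ)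
          (Real.exp (-(x * s)) * (-s) * s ^ μ) x := by
        have := (((hasDerivAt_id x).mul_const s).neg.exp).mul_const (s ^ μ)
        simpa using this
      have h2 := (h1.ofReal_comp.mul_const
        ((1 + Complex.I * ((s / 2 : ℝ) : ℂ)) ^ (μ : ℂ))).const_mul ((s : ℂ) ^ m)
      refine h2.congr_deriv ?_
      push_cast
      ring)).2
  rw [integral_neg] at this
  exact this

theorem hankelL_relation {μ : ℝ} (hμ : -1 < μ) {z : ℝ} (hz : 0 < z) :
    ((μ : ℂ) + 1) * (hankelL μ 0 z + Complex.I * hankelL μ 1 z)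
      - z * (hankelL μ 1 z + Complex.I / 2 * hankelL μ 2 z) = 0 := by
  have hK := fun m => hankelKernel_integrable hμ m hz
  set p : ℝ → ℂ := fun s => ((Real.exp (-(z * s)) * s ^ (μ + 1) : ℝ) : ℂ)
    * (1 + Complex.I * ((s / 2 : ℝ) : ℂ)) ^ ((μ : ℂ) + 1) with hp
  have hcont : ContinuousWithinAt p (Ici 0) 0 := by
    have h1 : ContinuousAt (fun s : ℝ => s ^ (μ + 1)) 0 :=
      Real.continuousAt_rpow_const _ _ (Or.inr (by linarith))
    have h2 : ContinuousAt (fun s : ℝ => (1 + Complex.I * ((s / 2 : ℝ) : ℂ)) ^ ((μ : ℂ) + 1)) 0 :=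
      ContinuousAt.cpow (by fun_prop) continuousAt_const (hankel_slit _)
    refine ContinuousAt.continuousWithinAt ?_
    refine ContinuousAt.mul (Complex.continuous_ofReal.continuousAt.comp ?_) h2
    exact ContinuousAt.mul (by fun_prop) h1
  have hder : ∀ s ∈ Ioi (0 : ℝ), HasDerivAt p
      (((μ : ℂ) + 1) * (hankelKernel μ 0 z s + Complex.I * hankelKernel μ 1 z s)
      - z * (hankelKernel μ 1 z s + Complex.I / 2 * hankelKernel μ 2 z s)) s := by
    intro s hs
    have hs : 0 < s := hs
    have h1 : HasDerivAt (fun s : ℝ => Real.exp (-(z * s)) * s ^ (μ + 1))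
        (Real.exp (-(z * s)) * (-z) * s ^ (μ + 1) + Real.exp (-(z * s)) * ((μ + 1) * s ^ μ)) s := by
      have a := ((hasDerivAt_id s).const_mul z).neg.exp
      have b := Real.hasDerivAt_rpow_const (x := s) (p := μ + 1) (Or.inl hs.ne')
      refine (a.mul b).congr_deriv ?_
      simp
    have h2 : HasDerivAt (fun w : ℂ => (1 + Complex.I * (w / 2)) ^ ((μ : ℂ) + 1))
        (((μ : ℂ) + 1) * (1 + Complex.I * ((s : ℂ) / 2)) ^ (μ : ℂ) * (Complex.I / 2)) (s : ℂ) := by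
      have a : HasDerivAt (fun w : ℂ => 1 + Complex.I * (w / 2)) (Complex.I / 2) (s : ℂ) := by
        have := (((hasDerivAt_id (s : ℂ)).div_const 2).const_mul Complex.I).const_add 1
        refine this.congr_deriv ?_
        ring
      have := a.cpow_const (c := (μ : ℂ) + 1) (by simpa using hankel_slit (s / 2))
      simpa using this
    have h3 := h1.ofReal_comp.mul h2.comp_ofReal
    have h4 : HasDerivAt p _ s := h3.congr_of_eventuallyEq (Eventually.of_forall fun s => by
      simp [hp])
    refine h4.congr_deriv ?_
    have h5 : (1 + Complex.I * ((s : ℂ) / 2)) ^ ((μ : ℂ) + 1)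
        = (1 + Complex.I * ((s : ℂ) / 2)) ^ (μ : ℂ) * (1 + Complex.I * ((s : ℂ) / 2)) := by
      rw [Complex.cpow_add _ _ (Complex.slitPlane_ne_zero (by simpa using hankel_slit (s / 2))),
        Complex.cpow_one]
    have h6 : s ^ (μ + 1) = s ^ μ * s := by
      rw [Real.rpow_add hs, Real.rpow_one]
    unfold hankelKernel
    push_cast [h5, h6]
    ring
  have hlim : Tendsto p atTop (𝓝 0) := by
    obtain ⟨C, hC, h⟩ := hankel_pow_le_exp (|μ + 1| + 1) (z / 2) (by positivity) (by positivity)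
    have h0 := (tendsto_rpow_mul_exp_neg_mul_atTop_nhds_zero (μ + 1) (z / 2)
      (by positivity)).const_mul C
    rw [mul_zero] at h0
    refine squeeze_zero_norm' ?_ h0
    filter_upwards [eventually_gt_atTop 0] with s hs
    have hb := hankel_base_bound (μ + 1) (s := s) (t := s / 2) (by positivity) (by linarith)
    rw [hp, norm_mul, Complex.norm_real, Real.norm_of_nonneg (by positivity)]
    push_cast at hb ⊢
    calc _ ≤ Real.exp (-(z * s)) * s ^ (μ + 1) * (C * Real.exp (z / 2 * s)) := by
          gcongr; exact hb.trans (h s hs.le)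
      _ = C * (s ^ (μ + 1) * Real.exp (-(z / 2) * s)) := by
          have : Real.exp (-(z / 2) * s) = Real.exp (-(z * s)) * Real.exp (z / 2 * s) := by
            rw [← Real.exp_add]; ring_nf
          rw [this]; ring
  have hI1 : IntegrableOn (fun s => ((μ : ℂ) + 1) * (hankelKernel μ 0 z s
      + Complex.I * hankelKernel μ 1 z s)) (Ioi 0) :=
    ((hK 0).add ((hK 1).const_mul _)).const_mul _
  have hI2 : IntegrableOn (fun s => (z : ℂ) * (hankelKernel μ 1 z s
      + Complex.I / 2 * hankelKernel μ 2 z s)) (Ioi 0) :=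
    ((hK 1).add ((hK 2).const_mul _)).const_mul _
  have key := integral_Ioi_of_hasDerivAt_of_tendsto hcont hder (hI1.sub hI2) hlim
  have hp0 : p 0 = 0 := by
    have : μ + 1 ≠ 0 := by linarith
    simp [hp, Real.zero_rpow this]
  rw [hp0, sub_zero, integral_sub hI1 hI2, integral_const_mul, integral_const_mul,
    integral_add (hK 0) ((hK 1).const_mul _), integral_add (hK 1) ((hK 2).const_mul _),
    integral_const_mul, integral_const_mul] at key
  exact key

theorem hankelH1_eq (ν : ℝ) : ∃ C : ℂ, ∀ z : ℝ, 0 < z →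
    hankelH1 ν z = C * ((z ^ ν : ℝ) : ℂ) * Complex.exp (Complex.I * z) * hankelL (ν - 1 / 2) 0 z := by
  refine ⟨((√(2 / Real.pi) : ℝ) : ℂ) * Complex.exp (Complex.I * ((-(ν * Real.pi / 2) - Real.pi / 4 : ℝ) : ℂ))
    / ((Real.Gamma (ν + 1 / 2) : ℝ) : ℂ), fun z hz => ?_⟩
  have h1 : (∫ t in Ioi (0 : ℝ), ((Real.exp (-t) * t ^ (ν - 1 / 2) : ℝ) : ℂ)
        * (1 + Complex.I * ((t / (2 * z) : ℝ) : ℂ)) ^ ((ν - 1 / 2 : ℝ) : ℂ))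
      = ((z ^ (ν + 1 / 2) : ℝ) : ℂ) * hankelL (ν - 1 / 2) 0 z := by
    have := integral_comp_mul_left_Ioi (fun t : ℝ => ((Real.exp (-t) * t ^ (ν - 1 / 2) : ℝ) : ℂ)
        * (1 + Complex.I * ((t / (2 * z) : ℝ) : ℂ)) ^ ((ν - 1 / 2 : ℝ) : ℂ)) 0 hz
    rw [mul_zero] at this
    have h2 : (∫ t in Ioi (0 : ℝ), ((Real.exp (-t) * t ^ (ν - 1 / 2) : ℝ) : ℂ)
        * (1 + Complex.I * ((t / (2 * z) : ℝ) : ℂ)) ^ ((ν - 1 / 2 : ℝ) : ℂ))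
        = z • (z⁻¹ • ∫ t in Ioi (0 : ℝ), ((Real.exp (-t) * t ^ (ν - 1 / 2) : ℝ) : ℂ)
        * (1 + Complex.I * ((t / (2 * z) : ℝ) : ℂ)) ^ ((ν - 1 / 2 : ℝ) : ℂ)) := by
      rw [smul_smul, mul_inv_cancel₀ hz.ne', one_smul]
    rw [h2, ← this, hankelL, Complex.real_smul, ← integral_const_mul, ← integral_const_mul]
    refine setIntegral_congr_fun measurableSet_Ioi fun s hs => ?_
    have hs : 0 < s := hs
    have h3 : z * s / (2 * z) = s / 2 := by field_simp
    have h4 : z ^ (ν + 1 / 2) = z * z ^ (ν - 1 / 2) := by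
      rw [show ν + 1 / 2 = 1 + (ν - 1 / 2) by ring, Real.rpow_add hz, Real.rpow_one]
    simp only [hankelKernel]
    rw [h3, h4, Real.mul_rpow hz.le hs.le]
    push_cast
    ring
  have h5 : √(2 / (Real.pi * z)) * z ^ (ν + 1 / 2) = √(2 / Real.pi) * z ^ ν := by
    rw [← div_div, Real.sqrt_div (by positivity), Real.rpow_add hz, ← Real.sqrt_eq_rpow]
    have : √z ≠ 0 := by positivity
    field_simp
  have h5' : ((√(2 / (Real.pi * z)) : ℝ) : ℂ) * ((z ^ (ν + 1 / 2) : ℝ) : ℂ)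
      = ((√(2 / Real.pi) : ℝ) : ℂ) * ((z ^ ν : ℝ) : ℂ) := by exact_mod_cast h5
  have h6 : Complex.exp (Complex.I * ((z - ν * Real.pi / 2 - Real.pi / 4 : ℝ) : ℂ))
      = Complex.exp (Complex.I * ((-(ν * Real.pi / 2) - Real.pi / 4 : ℝ) : ℂ))
        * Complex.exp (Complex.I * z) := by
    rw [← Complex.exp_add]; congr 1; push_cast; ring
  rw [hankelH1, h1, h6]
  linear_combination (Complex.exp (Complex.I * ((-(ν * Real.pi / 2) - Real.pi / 4 : ℝ) : ℂ))
        * Complex.exp (Complex.I * z) / ((Real.Gamma (ν + 1 / 2) : ℝ) : ℂ)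
        * hankelL (ν - 1 / 2) 0 z) * h5'

theorem hankelH1_spec {ν : ℝ} (hν : -1 / 2 < ν) : IsHankelH1 ν (hankelH1 ν) := by
  have hμ : -1 < ν - 1 / 2 := by linarith
  constructor
  · obtain ⟨C, hC⟩ := hankelH1_eq ν
    set L := fun m => hankelL (ν - 1 / 2) m with hL
    set e := fun z : ℝ => Complex.exp (Complex.I * z) with he
    have hed : ∀ z : ℝ, HasDerivAt e (Complex.I * e z) z := fun z => by
      have := ((hasDerivAt_id (z : ℂ)).const_mul Complex.I).cexp.comp_ofReal
      refine this.congr_deriv ?_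
      simp [he, mul_comm]
    have hpd : ∀ a z : ℝ, 0 < z →
        HasDerivAt (fun z : ℝ => ((z ^ a : ℝ) : ℂ)) ((a : ℂ) * ((z ^ (a - 1) : ℝ) : ℂ)) z :=
      fun a z hz => by
        have := (Real.hasDerivAt_rpow_const (x := z) (p := a) (Or.inl hz.ne')).ofReal_comp
        exact_mod_cast this
    have hpp : ∀ a z : ℝ, 0 < z → ((z ^ a : ℝ) : ℂ) = ((z ^ (a - 1) : ℝ) : ℂ) * z := fun a z hz => by
      rw [← Complex.ofReal_mul]
      congr 1
      conv_rhs => rw [← Real.rpow_one z, ← Real.rpow_mul hz.le, one_mul, ← Real.rpow_add hz]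
      ring_nf
    have hLd : ∀ m (z : ℝ), 0 < z → HasDerivAt (L m) (-L (m + 1) z) z :=
      fun m z hz => hankelL_hasDerivAt hμ m hz
    refine ⟨fun z => C * e z * ((ν : ℂ) * ((z ^ (ν - 1) : ℝ) : ℂ) * L 0 z
        + ((z ^ ν : ℝ) : ℂ) * (Complex.I * L 0 z - L 1 z)),
      fun z => C * e z * ((ν : ℂ) * ((ν : ℂ) - 1) * ((z ^ (ν - 1 - 1) : ℝ) : ℂ) * L 0 z
        + 2 * (ν : ℂ) * ((z ^ (ν - 1) : ℝ) : ℂ) * (Complex.I * L 0 z - L 1 z)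
        + ((z ^ ν : ℝ) : ℂ) * (-L 0 z - 2 * Complex.I * L 1 z + L 2 z)), fun z hz => ⟨?_, ?_, ?_⟩⟩
    · have h1 : hankelH1 ν =ᶠ[𝓝 z] fun z => C * ((z ^ ν : ℝ) : ℂ) * e z * L 0 z := by
        filter_upwards [Ioi_mem_nhds hz] with w hw using hC w hw
      refine HasDerivAt.congr_of_eventuallyEq ?_ h1
      refine ((((hpd ν z hz).const_mul C).mul (hed z)).mul (hLd 0 z hz)).congr_deriv ?_
      simp only [Pi.mul_apply]
      ring
    · refine (((hed z).const_mul C).mul ((((hpd (ν - 1) z hz).const_mul (ν : ℂ)).mul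
        (hLd 0 z hz)).add ((hpd ν z hz).mul (((hLd 0 z hz).const_mul Complex.I).sub
          (hLd 1 z hz))))).congr_deriv ?_
      simp only [Pi.mul_apply, Pi.add_apply, Pi.sub_apply]
      push_cast
      ring_nf
      rw [show Complex.I ^ 2 = -1 from Complex.I_sq]
      ring
    · have hrel := hankelL_relation hμ hz
      rw [hC z hz]
      beta_reduce
      change _ + _ + _ * (C * _ * e z * L 0 z) = 0
      change (((ν - 1 / 2 : ℝ) : ℂ) + 1) * (L 0 z + Complex.I * L 1 z)
        - z * (L 1 z + Complex.I / 2 * L 2 z) = 0 at hrel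
      rw [hpp ν z hz, hpp (ν - 1) z hz]
      push_cast at hrel
      have hI : Complex.I ^ 2 = -1 := Complex.I_sq
      linear_combination (2 * Complex.I * C * e z * ((z ^ (ν - 1 - 1) : ℝ) : ℂ) * (z : ℂ) ^ 3) * hrel
        + (C * e z * ((z ^ (ν - 1 - 1) : ℝ) : ℂ) * (z : ℂ) ^ 3
          * (-(2 * ν + 1) * L 1 z + z * L 2 z)) * hI
  · have hG : 0 < Real.Gamma (ν + 1 / 2) := Real.Gamma_pos_of_pos (by linarith)
    have hGc : ((Real.Gamma (ν + 1 / 2) : ℝ) : ℂ) ≠ 0 := by exact_mod_cast hG.ne'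
    have hlim : Tendsto (fun z : ℝ => ∫ t in Ioi (0 : ℝ), ((Real.exp (-t) * t ^ (ν - 1 / 2) : ℝ) : ℂ)
        * (1 + Complex.I * ((t / (2 * z) : ℝ) : ℂ)) ^ ((ν - 1 / 2 : ℝ) : ℂ)) atTop
        (𝓝 ((Real.Gamma (ν + 1 / 2) : ℝ) : ℂ)) := by
      have hgam : ((Real.Gamma (ν + 1 / 2) : ℝ) : ℂ)
          = ∫ t in Ioi (0 : ℝ), ((Real.exp (-t) * t ^ (ν - 1 / 2) : ℝ) : ℂ) := by
        rw [integral_complex_ofReal, Real.Gamma_eq_integral (by linarith)]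
        congr 3
        ext t
        ring_nf
      rw [hgam]
      refine tendsto_integral_filter_of_dominated_convergence (hankelMaj (ν - 1 / 2) 0 1) ?_ ?_
        (hankelMaj_integrable hμ 0 one_pos) ?_
      · refine Eventually.of_forall fun z => ?_
        have h2 : Measurable fun s : ℝ => s ^ (ν - 1 / 2) := by fun_prop
        have h3 : Measurable fun t : ℝ =>
          (1 + Complex.I * ((t / (2 * z) : ℝ) : ℂ)) ^ ((ν - 1 / 2 : ℝ) : ℂ) := by fun_prop
        exact (by fun_prop : Measurable _).aestronglyMeasurable
      · filter_upwards [eventually_ge_atTop 1] with z hz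
        refine (ae_restrict_iff' measurableSet_Ioi).2 (Eventually.of_forall fun t ht => ?_)
        have ht : 0 < t := ht
        rw [norm_mul, Complex.norm_real, Real.norm_of_nonneg (by positivity)]
        unfold hankelMaj
        rw [pow_zero, one_mul, one_mul]
        gcongr
        refine hankel_base_bound _ (by positivity) ?_
        rw [div_le_iff₀ (by positivity)]
        nlinarith
      · refine Eventually.of_forall fun t => ?_
        have h1 : Tendsto (fun z : ℝ => 1 + Complex.I * ((t / (2 * z) : ℝ) : ℂ)) atTop (𝓝 1) := by
          have h2 : Tendsto (fun z : ℝ => t / (2 * z)) atTop (𝓝 0) :=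
            tendsto_const_nhds.div_atTop (tendsto_id.const_mul_atTop two_pos)
          have h3 := (Complex.continuous_ofReal.tendsto 0).comp h2
          have h4 := (h3.const_mul Complex.I).const_add 1
          simpa using h4
        have h5 := (h1.cpow (tendsto_const_nhds (x := ((ν - 1 / 2 : ℝ) : ℂ)))
          (by simp [Complex.slitPlane])).const_mul
          ((Real.exp (-t) * t ^ (ν - 1 / 2) : ℝ) : ℂ)
        simpa using h5
    refine (Asymptotics.isEquivalent_iff_tendsto_one ?_).2 ?_
    · filter_upwards [eventually_gt_atTop 0] with z hz
      have : 0 < √(2 / (Real.pi * z)) := by positivity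
      exact mul_ne_zero (by exact_mod_cast this.ne') (Complex.exp_ne_zero _)
    · have h1 := hlim.div_const ((Real.Gamma (ν + 1 / 2) : ℝ) : ℂ)
      rw [div_self hGc] at h1
      refine h1.congr' ?_
      filter_upwards [eventually_gt_atTop 0] with z hz
      have : 0 < √(2 / (Real.pi * z)) := by positivity
      have h2 : ((√(2 / (Real.pi * z)) : ℝ) : ℂ) ≠ 0 := by exact_mod_cast this.ne'
      have h3 := Complex.exp_ne_zero (Complex.I * ((z - ν * Real.pi / 2 - Real.pi / 4 : ℝ) : ℂ))
      rw [Pi.div_apply, hankelH1]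
      generalize ((√(2 / (Real.pi * z)) : ℝ) : ℂ) = a at h2
      generalize Complex.exp (Complex.I * ((z - ν * Real.pi / 2 - Real.pi / 4 : ℝ) : ℂ)) = b at h3
      field_simp

theorem bessel_eq_zero {ν : ℝ} {w w' w'' : ℝ → ℂ}
    (h1 : ∀ z : ℝ, 0 < z → HasDerivAt w (w' z) z) (h2 : ∀ z : ℝ, 0 < z → HasDerivAt w' (w'' z) z)
    (hode : ∀ z : ℝ, 0 < z →
      (z : ℂ) ^ 2 * w'' z + (z : ℂ) * w' z + ((z : ℂ) ^ 2 - (ν : ℂ) ^ 2) * w z = 0)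
    (hlim : Tendsto (fun z : ℝ => ((√z : ℝ) : ℂ) * w z) atTop (𝓝 0)) :
    ∀ z : ℝ, 0 < z → w z = 0 := by
  set c : ℝ := ν ^ 2 - 1 / 4 with hc
  set f : ℝ → ℂ := fun z => ((√z : ℝ) : ℂ) * w z with hf
  set f' : ℝ → ℂ := fun z => ((1 / (2 * √z) : ℝ) : ℂ) * w z + ((√z : ℝ) : ℂ) * w' z with hf'
  have hfd : ∀ z : ℝ, 0 < z → HasDerivAt f (f' z) z := fun z hz =>
    ((Real.hasDerivAt_sqrt hz.ne').ofReal_comp.mul (h1 z hz))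
  have hfd' : ∀ z : ℝ, 0 < z → HasDerivAt f' (((-(1 - c / z ^ 2) : ℝ) : ℂ) * f z) z := by
    intro z hz
    have hs : √z ≠ 0 := by positivity
    have hsq : √z ^ 2 = z := Real.sq_sqrt hz.le
    have a : HasDerivAt (fun z : ℝ => 1 / (2 * √z)) (-(1 / (4 * (√z * z)))) z := by
      have := ((Real.hasDerivAt_sqrt hz.ne').const_mul 2).inv (by positivity)
      refine (this.congr_of_eventuallyEq
        (Eventually.of_forall fun z => by simp [one_div])).congr_deriv ?_
      rw [← hsq, Real.sqrt_sq (by positivity)]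
      field_simp
      norm_num
    have b := (a.ofReal_comp.mul (h1 z hz)).add
      ((Real.hasDerivAt_sqrt hz.ne').ofReal_comp.mul (h2 z hz))
    refine HasDerivAt.congr_deriv (f := f') b ?_
    have ho := hode z hz
    have hzc : (z : ℂ) ≠ 0 := by exact_mod_cast hz.ne'
    have hsc : ((√z : ℝ) : ℂ) ≠ 0 := by exact_mod_cast hs
    have hsqc : ((√z : ℝ) : ℂ) ^ 2 = z := by exact_mod_cast hsq
    simp only [hf, hc]
    push_cast
    rw [← hsqc] at ho ⊢
    field_simp
    ring_nf at ho ⊢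
    linear_combination 8 * ho
  have hf0 : Tendsto (fun z => ‖f z‖) atTop (𝓝 0) := by simpa using hlim.norm
  have hf'0 : Tendsto (fun z => ‖f' z‖) atTop (𝓝 0) := by
    rw [Metric.tendsto_atTop]
    intro ε hε
    obtain ⟨R, hR⟩ := (Metric.tendsto_atTop.1 hf0) (ε / (8 * (1 + |c|))) (by positivity)
    refine ⟨max R 1, fun z hz => ?_⟩
    have hz1 : 1 ≤ z := (le_max_right _ _).trans hz
    have hzR : R ≤ z := (le_max_left _ _).trans hz
    have hfs : ∀ s, z ≤ s → ‖f s‖ ≤ ε / (8 * (1 + |c|)) := fun s hs => by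
      have := hR s (hzR.trans hs)
      rw [Real.dist_eq, sub_zero, abs_norm] at this
      exact this.le
    have hc1 : 0 < 1 + |c| := by positivity
    have hε8 : ε / (8 * (1 + |c|)) * (1 + |c|) = ε / 8 := by field_simp
    have hε8' : ε / (8 * (1 + |c|)) ≤ ε / 8 := by
      rw [← hε8]
      exact le_mul_of_one_le_right (by positivity) (by linarith [abs_nonneg c])
    have hd2 : ∀ s ∈ Icc z (z + 1), ‖((-(1 - c / s ^ 2) : ℝ) : ℂ) * f s‖ ≤ ε / 8 := by
      intro s hs
      have hs1 : 1 ≤ s := hz1.trans hs.1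
      rw [norm_mul, Complex.norm_real, Real.norm_eq_abs, abs_neg, ← hε8, mul_comm]
      have : |1 - c / s ^ 2| ≤ 1 + |c| := by
        refine (abs_sub _ _).trans ?_
        rw [abs_one, abs_div, abs_of_pos (by positivity : (0 : ℝ) < s ^ 2)]
        gcongr
        exact div_le_self (abs_nonneg c) (by nlinarith)
      exact mul_le_mul (hfs s hs.1) this (abs_nonneg _) (by positivity)
    have hmem : z ∈ Icc z (z + 1) := ⟨le_rfl, by linarith⟩
    have hd1 : ∀ s ∈ Icc z (z + 1), ‖f' s - f' z‖ ≤ ε / 8 := by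
      intro s hs
      have := Convex.norm_image_sub_le_of_norm_hasDerivWithin_le
        (fun x hx => (hfd' x (by linarith [hx.1])).hasDerivWithinAt) hd2 (convex_Icc _ _) hmem hs
      refine this.trans ?_
      have : ‖s - z‖ ≤ 1 := by
        rw [Real.norm_eq_abs, abs_le]; constructor <;> linarith [hs.1, hs.2]
      nlinarith
    have hp := Convex.norm_image_sub_le_of_norm_hasDerivWithin_le
      (f := fun s : ℝ => f s - (s : ℂ) * f' z) (f' := fun s => f' s - f' z)
      (fun x hx => (((hfd x (by linarith [hx.1])).sub
        ((Complex.ofRealCLM.hasDerivAt (x := x)).mul_const (f' z))).congr_deriv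
          (by simp)).hasDerivWithinAt) hd1 (convex_Icc _ _) hmem
      (⟨by linarith, le_rfl⟩ : z + 1 ∈ Icc z (z + 1))
    have hp2 : f' z = f (z + 1) - f z
        - ((f (z + 1) - ((z + 1 : ℝ) : ℂ) * f' z) - (f z - (z : ℂ) * f' z)) := by
      push_cast; ring
    rw [Real.dist_eq, sub_zero, abs_norm, hp2]
    have hn : ‖(z + 1) - z‖ = 1 := by simp
    rw [hn, mul_one] at hp
    have := hfs z le_rfl
    have := hfs (z + 1) (by linarith)
    calc _ ≤ ‖f (z + 1)‖ + ‖f z‖ + ε / 8 :=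
          (norm_sub_le _ _).trans (add_le_add (norm_sub_le _ _) hp)
      _ < ε := by linarith
  set E : ℝ → ℝ := fun z => (‖f z‖ ^ 2 + ‖f' z‖ ^ 2) * Real.exp (-(|c| * z⁻¹)) with hE
  have hEd : ∀ z : ℝ, 0 < z → HasDerivAt E
      ((2 * inner ℝ (f z) (f' z) + 2 * inner ℝ (f' z) (((-(1 - c / z ^ 2) : ℝ) : ℂ) * f z))
        * Real.exp (-(|c| * z⁻¹)) + (‖f z‖ ^ 2 + ‖f' z‖ ^ 2)
        * (Real.exp (-(|c| * z⁻¹)) * (-(|c| * -(z ^ 2)⁻¹)))) z := fun z hz =>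
    ((hfd z hz).norm_sq.add (hfd' z hz).norm_sq).mul
      (((hasDerivAt_inv hz.ne').const_mul |c|).neg.exp)
  have hmono : MonotoneOn E (Ioi 0) := by
    refine monotoneOn_of_deriv_nonneg (convex_Ioi 0)
      (fun z hz => (hEd z hz).continuousAt.continuousWithinAt)
      (fun z hz => by
        rw [interior_Ioi] at hz
        exact (hEd z hz).differentiableAt.differentiableWithinAt) (fun z hz => ?_)
    rw [interior_Ioi] at hz
    have hz : 0 < z := hz
    rw [(hEd z hz).deriv, ← Complex.real_smul, inner_smul_right, real_inner_comm (f z) (f' z)]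
    have hi := abs_real_inner_le_norm (f z) (f' z)
    have hi2 : |c * inner ℝ (f z) (f' z)| ≤ |c| * (‖f z‖ * ‖f' z‖) := by
      rw [abs_mul]; gcongr
    have h3 : 0 ≤ 2 * (c * inner ℝ (f z) (f' z)) + |c| * (‖f z‖ ^ 2 + ‖f' z‖ ^ 2) := by
      have := (abs_le.1 hi2).1
      nlinarith [mul_nonneg (abs_nonneg c) (sq_nonneg (‖f z‖ - ‖f' z‖))]
    have h4 : 0 ≤ (z ^ 2)⁻¹ * Real.exp (-(|c| * z⁻¹)) := by positivity
    have h5 := mul_nonneg h4 h3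
    refine h5.trans_eq ?_
    rw [real_inner_comm (f' z) (f z)]
    field_simp
    ring
  have hE0 : Tendsto E atTop (𝓝 0) := by
    refine squeeze_zero' (Eventually.of_forall fun z => by positivity) ?_
      (by simpa using (hf0.pow 2).add (hf'0.pow 2))
    filter_upwards [eventually_gt_atTop 0] with z hz
    refine mul_le_of_le_one_right (by positivity) ?_
    rw [Real.exp_le_one_iff]
    have : 0 ≤ |c| * z⁻¹ := by positivity
    linarith
  intro z hz
  have hle : E z ≤ 0 := by
    refine ge_of_tendsto hE0 ?_
    filter_upwards [eventually_ge_atTop z] with s hs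
    exact hmono hz (hz.trans_le hs) hs
  have h6 : ‖f z‖ ^ 2 + ‖f' z‖ ^ 2 ≤ 0 := by
    by_contra hcon
    push Not at hcon
    have : 0 < E z := by simp only [hE]; positivity
    linarith
  have h7 : ‖f z‖ = 0 := by nlinarith [sq_nonneg ‖f z‖, sq_nonneg ‖f' z‖, norm_nonneg (f z)]
  have h8 : ((√z : ℝ) : ℂ) * w z = 0 := norm_eq_zero.1 h7
  have hs : ((√z : ℝ) : ℂ) ≠ 0 := by
    have : √z ≠ 0 := by positivity
    exact_mod_cast this
  exact (mul_eq_zero.1 h8).resolve_left hs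

/-- `hankelH1 ν` is, on the positive half-line, the one and only function with the defining
property of the Hankel function of the first kind. -/
theorem isHankelH1_iff {ν : ℝ} (hν : -1 / 2 < ν) (H : ℝ → ℂ) :
    IsHankelH1 ν H ↔ ∀ z : ℝ, 0 < z → H z = hankelH1 ν z := by
  have hs := hankelH1_spec hν
  constructor
  · intro hH z hz
    obtain ⟨A', A'', hA⟩ := hH.bessel
    obtain ⟨B', B'', hB⟩ := hs.bessel
    have ho := hH.asymptotic.trans hs.asymptotic.symm
    refine sub_eq_zero.1 (bessel_eq_zero (ν := ν) (w := fun z => H z - hankelH1 ν z)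
      (w' := fun z => A' z - B' z) (w'' := fun z => A'' z - B'' z)
      (fun z hz => (hA z hz).1.sub (hB z hz).1) (fun z hz => (hA z hz).2.1.sub (hB z hz).2.1)
      (fun z hz => by linear_combination (hA z hz).2.2 - (hB z hz).2.2) ?_ z hz)
    have h1 : (fun z => H z - hankelH1 ν z) =o[atTop] fun z : ℝ =>
        ((√(2 / (Real.pi * z)) : ℝ) : ℂ)
        * Complex.exp (Complex.I * ((z - ν * Real.pi / 2 - Real.pi / 4 : ℝ) : ℂ)) :=
      ho.isLittleO.trans_isBigO hs.asymptotic.isBigO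
    have h2 := (Asymptotics.isBigO_refl (fun z : ℝ => ((√z : ℝ) : ℂ)) atTop).mul_isLittleO h1
    have h3 : (fun z : ℝ => ((√z : ℝ) : ℂ) * (((√(2 / (Real.pi * z)) : ℝ) : ℂ)
        * Complex.exp (Complex.I * ((z - ν * Real.pi / 2 - Real.pi / 4 : ℝ) : ℂ))))
        =O[atTop] fun _ => (1 : ℂ) := by
      refine Asymptotics.IsBigO.of_bound (√(2 / Real.pi)) ?_
      filter_upwards [eventually_gt_atTop 0] with z hz
      have he : ‖Complex.exp (Complex.I * ((z - ν * Real.pi / 2 - Real.pi / 4 : ℝ) : ℂ))‖ = 1 := by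
        rw [mul_comm, Complex.norm_exp_ofReal_mul_I]
      rw [norm_mul, norm_mul, he, Complex.norm_real, Complex.norm_real,
        Real.norm_of_nonneg (by positivity), Real.norm_of_nonneg (by positivity), norm_one, mul_one,
        mul_one, ← Real.sqrt_mul hz.le]
      apply le_of_eq
      congr 1
      field_simp
    exact (Asymptotics.isLittleO_one_iff ℂ).1 (h2.trans_isBigO h3)
  · intro h
    obtain ⟨B', B'', hB⟩ := hs.bessel
    refine ⟨⟨B', B'', fun z hz => ⟨?_, (hB z hz).2.1, ?_⟩⟩, ?_⟩
    · exact (hB z hz).1.congr_of_eventuallyEq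
        (by filter_upwards [Ioi_mem_nhds hz] with s hs using h s hs)
    · rw [h z hz]; exact (hB z hz).2.2
    · refine hs.asymptotic.congr_left ?_
      filter_upwards [eventually_gt_atTop 0] with s hs using (h s hs).symm

end HankelFacts

/-- The space `ℝ^N` with the Euclidean norm. -/
abbrev RN (N : ℕ) : Type := EuclideanSpace ℝ (Fin N)

/-- The Banach space `L^∞(ℝ^N)` of (classes of) complex-valued functions, Lebesgue measure. -/
abbrev LInfty (N : ℕ) : Type :=
  MeasureTheory.Lp ℂ ⊤ (MeasureTheory.volume : MeasureTheory.Measure (RN N))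

/-- The weight `⟨x⟩ = (1 + |x|²)^{1/2}`. -/
noncomputable def japaneseBracket {N : ℕ} (x : RN N) : ℝ := (1 + ‖x‖ ^ 2) ^ (1 / 2 : ℝ)

/-- The outgoing fundamental solution of the Helmholtz equation,
`Φ_k(x) = (i/4) (k / (2π|x|))^{(N-2)/2} H^{(1)}_{(N-2)/2}(k|x|)`, for `x ≠ 0`
(the value at the single point `x = 0` plays no role). -/
noncomputable def helmholtzPhi {N : ℕ} (k : ℝ) (x : RN N) : ℂ :=
  Complex.I / 4 * (((k / (2 * Real.pi * ‖x‖)) ^ (((N : ℝ) - 2) / 2) : ℝ) : ℂ)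
    * hankelH1 (((N : ℝ) - 2) / 2) (k * ‖x‖)

/-- The convolution integral `(Φ_k * h)(x)` converges absolutely for every `x`. -/
def ResolventDefined {N : ℕ} (k : ℝ) (h : RN N → ℂ) : Prop :=
  MeasureTheory.ConvolutionExists (helmholtzPhi k) h (ContinuousLinearMap.mul ℝ ℂ)
    MeasureTheory.volume

/-- The Helmholtz resolvent `R_k h = Φ_k * h`. -/
noncomputable def helmholtzResolvent {N : ℕ} (k : ℝ) (h : RN N → ℂ) : RN N → ℂ :=
  MeasureTheory.convolution (helmholtzPhi k) h (ContinuousLinearMap.mul ℝ ℂ)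
    MeasureTheory.volume

/-- The substitution operator `N_f(u)(x) = f(x, u(x))`. -/
def substitutionOp {N : ℕ} (f : RN N → ℂ → ℂ) (u : RN N → ℂ) : RN N → ℂ := fun x => f x (u x)

/-- `u` solves `u = R_k(N_f(u)) + φ` in `L^∞(ℝ^N)`, i.e. almost everywhere. -/
def SolvesHelmholtzEq {N : ℕ} (k : ℝ) (f : RN N → ℂ → ℂ) (φ u : LInfty N) : Prop :=
  ∀ᵐ x : RN N, u x = helmholtzResolvent k (substitutionOp f u) x + φ x

open MeasureTheory Set Filter Topology

/-! The equation reads `P u = φ` with `P u = u - R_k(N_f(u))`, where `P 0 = 0`. If `P` is a `C^1`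
map of `L^∞` whose derivative at zero is the identity, the inverse function theorem gives the
neighborhoods and the `C^1` solution map. The work lies in showing that `R_k ∘ N_f` is `C^1`.

Fix `β` strictly between `(N+1)/2` and `α` and split `R_k ∘ N_f = T ∘ G`, where `G u = (1+|x|)^β
f(x,u)` and `T` divides by `(1+|x|)^β` and then convolves with `Φ_k`. The linear map `T` is bounded
on `L^∞` because `|Φ_k|` has an integrable singularity and decays like `|x|^{-(N-1)/2}`, so that `β
> (N+1)/2` makes `∫ |Φ_k(t)| (1+|x-t|)^{-β} dt` bounded in `x` (`helmholtzPhi_weighted_bound`,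
`exists_weighted_resolvent_clm`). The map `G` is a substitution operator. Since `β < α`, the
weighted derivative of `f` still tends to zero at infinity, hence is uniformly continuous in `u`
uniformly in `x` (`locallyUniformlyContinuousUniformly_weightMul`), and this makes `G` of class
`C^1` (`contDiff_nemytskii`). As `f'(x,0) = 0`, the derivative of `G` at zero vanishes. -/

/-! ### Pointwise bounds on the Hankel function and on `Φ_k`. -/

/-- In Hankel's integral the base `1 + it/(2z)` has modulus between `1` and `(1+1/z)(1+t)`. Its
power therefore splits into a factor in `z` and one in `t` absorbed by the integrable `hankelMaj`.
The lower bound `1` allows a negative exponent to be replaced by zero. One estimate thus serves both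
small and large `z`. -/
theorem hankelH1_norm_le (ν : ℝ) (hν : -1 / 2 < ν) :
    ∃ C : ℝ, 0 ≤ C ∧ ∀ z : ℝ, 0 < z →
      ‖hankelH1 ν z‖ ≤ C * z ^ (-(1 / 2) : ℝ) * (1 + 1 / z) ^ max 0 (ν - 1 / 2) := by
  set μ := ν - 1 / 2 with hμ
  set m := max 0 μ with hm
  set K := ∫ t in Ioi (0 : ℝ), hankelMaj μ 0 1 t with hK
  have hmaj : ∀ t ∈ Ioi (0 : ℝ), 0 ≤ hankelMaj μ 0 1 t := fun t ht => by
    have ht : 0 < t := ht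
    unfold hankelMaj; positivity
  have hK0 : 0 ≤ K := setIntegral_nonneg measurableSet_Ioi hmaj
  have hΓ : 0 < Real.Gamma (ν + 1 / 2) := Real.Gamma_pos_of_pos (by linarith)
  refine ⟨√(2 / Real.pi) / Real.Gamma (ν + 1 / 2) * K, by positivity, fun z hz => ?_⟩
  have hint : ‖∫ t in Ioi (0 : ℝ), ((Real.exp (-t) * t ^ μ : ℝ) : ℂ)
      * (1 + Complex.I * ((t / (2 * z) : ℝ) : ℂ)) ^ ((μ : ℝ) : ℂ)‖ ≤ (1 + 1 / z) ^ m * K := by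
    rw [hK, ← integral_const_mul]
    refine norm_integral_le_of_norm_le
      ((hankelMaj_integrable (by linarith) 0 one_pos).const_mul _) ?_
    refine (ae_restrict_iff' measurableSet_Ioi).2 (Eventually.of_forall fun t ht => ?_)
    have ht : 0 < t := ht
    rw [norm_mul, Complex.norm_real, Real.norm_of_nonneg (by positivity), Complex.norm_cpow_real]
    set y := 1 + Complex.I * ((t / (2 * z) : ℝ) : ℂ) with hy
    have h1 : 1 ≤ ‖y‖ := by
      have := Complex.re_le_norm y
      have h0 : y.re = 1 := by simp [hy, -Complex.ofReal_div]
      rwa [h0] at this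
    have h2 : ‖y‖ ≤ (1 + 1 / z) * (1 + t) := by
      refine (norm_add_le _ _).trans ?_
      have h3 : t / (2 * z) ≤ 1 / z * t := by
        rw [div_le_iff₀ (by positivity)]; field_simp; linarith
      have h4 : ‖((t / (2 * z) : ℝ) : ℂ)‖ = t / (2 * z) := by
        rw [Complex.norm_real, Real.norm_of_nonneg (by positivity)]
      rw [norm_mul, h4, Complex.norm_I, norm_one]
      have : 0 < 1 / z := by positivity
      nlinarith
    have h5 : ‖y‖ ^ μ ≤ (1 + 1 / z) ^ m * (1 + t) ^ (|μ| + 1) := by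
      calc ‖y‖ ^ μ ≤ ‖y‖ ^ m := Real.rpow_le_rpow_of_exponent_le h1 (le_max_right _ _)
        _ ≤ ((1 + 1 / z) * (1 + t)) ^ m :=
          Real.rpow_le_rpow (norm_nonneg _) h2 (le_max_left _ _)
        _ = (1 + 1 / z) ^ m * (1 + t) ^ m := Real.mul_rpow (by positivity) (by positivity)
        _ ≤ _ := by
          gcongr
          · linarith
          · exact max_le (by positivity) (by linarith [le_abs_self μ])
    unfold hankelMaj
    calc _ ≤ Real.exp (-t) * t ^ μ * ((1 + 1 / z) ^ m * (1 + t) ^ (|μ| + 1)) := by gcongr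
      _ = _ := by rw [one_mul, pow_zero]; ring
  have hexp : ‖Complex.exp (Complex.I * ((z - ν * Real.pi / 2 - Real.pi / 4 : ℝ) : ℂ))‖ = 1 := by
    rw [mul_comm, Complex.norm_exp_ofReal_mul_I]
  have hsq : √(2 / (Real.pi * z)) = √(2 / Real.pi) * z ^ (-(1 / 2) : ℝ) := by
    rw [← div_div, Real.sqrt_div (by positivity), Real.rpow_neg hz.le, ← Real.sqrt_eq_rpow]
    rfl
  unfold hankelH1
  rw [norm_mul, norm_div, norm_mul, hexp, Complex.norm_real, Complex.norm_real,
    Real.norm_of_nonneg (by positivity), Real.norm_of_nonneg hΓ.le, hsq, mul_one]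
  calc _ ≤ √(2 / Real.pi) * z ^ (-(1 / 2) : ℝ) / Real.Gamma (ν + 1 / 2) * ((1 + 1 / z) ^ m * K) := by
        gcongr
    _ = _ := by ring

theorem measurable_hankelH1 (ν : ℝ) : Measurable (hankelH1 ν) := by
  have h : StronglyMeasurable fun z : ℝ => ∫ t in Ioi (0 : ℝ),
      ((Real.exp (-t) * t ^ (ν - 1 / 2) : ℝ) : ℂ)
        * (1 + Complex.I * ((t / (2 * z) : ℝ) : ℂ)) ^ ((ν - 1 / 2 : ℝ) : ℂ) := by
    refine StronglyMeasurable.integral_prod_right (f := fun z t : ℝ =>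
      ((Real.exp (-t) * t ^ (ν - 1 / 2) : ℝ) : ℂ)
        * (1 + Complex.I * ((t / (2 * z) : ℝ) : ℂ)) ^ ((ν - 1 / 2 : ℝ) : ℂ)) ?_
    exact (by fun_prop : Measurable _).stronglyMeasurable
  unfold hankelH1
  have := h.measurable
  fun_prop

theorem measurable_helmholtzPhi {N : ℕ} (k : ℝ) :
    Measurable (helmholtzPhi k : RN N → ℂ) := by
  have := (measurable_hankelH1 (((N : ℝ) - 2) / 2)).comp
    (measurable_norm.const_mul k : Measurable fun x : RN N => k * ‖x‖)
  unfold helmholtzPhi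
  simp only [Function.comp_def] at this
  fun_prop

/-- Up to a constant, `Φ_k` is bounded by an integrable singularity at the origin and by
`(1 + |x|)^{-(N-1)/2}` at infinity. -/
theorem helmholtzPhi_norm_le {N : ℕ} (hN : 2 ≤ N) {k : ℝ} (hk : 0 < k) :
    ∃ C b : ℝ, 0 ≤ C ∧ b < N ∧ ∀ x : RN N, x ≠ 0 → ‖helmholtzPhi k x‖ ≤
      C * ((Iio (1 : ℝ)).indicator (fun r => r ^ (-b)) ‖x‖
        + (1 + ‖x‖) ^ (-(((N : ℝ) - 1) / 2))) := by
  have hN' : (2 : ℝ) ≤ N := by exact_mod_cast hN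
  set ν := ((N : ℝ) - 2) / 2 with hν
  have hν0 : 0 ≤ ν := by rw [hν]; linarith
  set m := max 0 (ν - 1 / 2) with hm
  have hm0 : 0 ≤ m := le_max_left _ _
  have ha : ((N : ℝ) - 1) / 2 = ν + 1 / 2 := by rw [hν]; ring
  set a := ((N : ℝ) - 1) / 2 with ha'
  have ha0 : 0 ≤ a := by linarith
  obtain ⟨C, hC, hH⟩ := hankelH1_norm_le ν (by linarith)
  set D := 1 / 4 * (k / (2 * Real.pi)) ^ ν * (C * k ^ (-(1 / 2) : ℝ)) * (1 + 1 / k) ^ m with hD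
  have hD0 : 0 ≤ D := by positivity
  have key : ∀ x : RN N, x ≠ 0 → ‖helmholtzPhi k x‖ ≤ D * ‖x‖ ^ (-a) * (1 + 1 / ‖x‖) ^ m := by
    intro x hx
    have hr : 0 < ‖x‖ := norm_pos_iff.2 hx
    set r := ‖x‖
    unfold helmholtzPhi
    rw [norm_mul, norm_mul, Complex.norm_real, Real.norm_of_nonneg (by positivity)]
    have h1 : ‖Complex.I / 4‖ = 1 / 4 := by simp
    have h2 : (k / (2 * Real.pi * r)) ^ ν = (k / (2 * Real.pi)) ^ ν * r ^ (-ν) := by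
      rw [← div_div, Real.div_rpow (by positivity) hr.le, Real.rpow_neg hr.le]; rfl
    have h3 : (1 + 1 / (k * r)) ^ m ≤ (1 + 1 / k) ^ m * (1 + 1 / r) ^ m := by
      rw [← Real.mul_rpow (by positivity) (by positivity)]
      refine Real.rpow_le_rpow (by positivity) ?_ hm0
      have : (1 + 1 / k) * (1 + 1 / r) = 1 + 1 / (k * r) + (1 / k + 1 / r) := by
        field_simp; ring
      have : 0 < 1 / k + 1 / r := by positivity
      linarith
    have h4 : r ^ (-a) = r ^ (-ν) * r ^ (-(1 / 2) : ℝ) := by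
      rw [← Real.rpow_add hr, ha]; congr 1; ring
    have h5 := hH (k * r) (by positivity)
    rw [Real.mul_rpow hk.le hr.le] at h5
    rw [h1, h2, h4]
    calc _ ≤ 1 / 4 * ((k / (2 * Real.pi)) ^ ν * r ^ (-ν)) *
          (C * (k ^ (-(1 / 2) : ℝ) * r ^ (-(1 / 2) : ℝ)) * ((1 + 1 / k) ^ m * (1 + 1 / r) ^ m)) := by
          gcongr
          exact h5.trans (by gcongr)
      _ = _ := by rw [hD]; ring
  -- The factor `2 ^ m` comes from `1 + 1/r ≤ 2/r` for `r < 1` and `1 + 1/r ≤ 2` for `r ≥ 1`; the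
  -- factor `2 ^ a` from `1 + r ≤ 2r` for `r ≥ 1`. The singular exponent `a + m` is `(N-1)/2` if `m
  -- = 0` and `N - 2` otherwise, below `N` in both cases.
  refine ⟨D * 2 ^ m * 2 ^ a, a + m, by positivity, ?_, fun x hx => (key x hx).trans ?_⟩
  · rcases max_cases 0 (ν - 1 / 2) with h | h <;> rw [hm, h.1] <;> linarith
  have hr : 0 < ‖x‖ := norm_pos_iff.2 hx
  set r := ‖x‖
  have h2a : (1 : ℝ) ≤ 2 ^ a := Real.one_le_rpow (by norm_num) ha0
  have hp : (0 : ℝ) ≤ (1 + r) ^ (-a) := by positivity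
  by_cases h : r < 1
  · rw [indicator_of_mem (show r ∈ Iio 1 from h)]
    have h6 : (1 + 1 / r) ^ m ≤ 2 ^ m * r ^ (-m) := by
      rw [Real.rpow_neg hr.le, ← Real.inv_rpow hr.le, ← Real.mul_rpow (by norm_num) (by positivity)]
      refine Real.rpow_le_rpow (by positivity) ?_ hm0
      have : 1 ≤ r⁻¹ := (one_le_inv₀ hr).2 h.le
      rw [one_div]; linarith
    calc _ ≤ D * r ^ (-a) * (2 ^ m * r ^ (-m)) := by gcongr
      _ = D * 2 ^ m * 1 * r ^ (-(a + m)) := by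
        rw [neg_add, Real.rpow_add hr]; ring
      _ ≤ D * 2 ^ m * 2 ^ a * r ^ (-(a + m)) := by gcongr
      _ ≤ _ := by
        gcongr
        exact le_add_of_nonneg_right hp
  · push Not at h
    rw [indicator_of_notMem (by simpa using h), zero_add]
    have h6 : (1 + 1 / r) ^ m ≤ 2 ^ m := by
      refine Real.rpow_le_rpow (by positivity) ?_ hm0
      have : 1 / r ≤ 1 := by rw [div_le_one hr]; exact h
      linarith
    have h7 : r ^ (-a) ≤ 2 ^ a * (1 + r) ^ (-a) := by
      rw [Real.rpow_neg hr.le, Real.rpow_neg (by positivity), ← Real.inv_rpow hr.le,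
        ← Real.inv_rpow (by positivity), ← Real.mul_rpow (by norm_num) (by positivity)]
      refine Real.rpow_le_rpow (by positivity) ?_ ha0
      rw [← div_eq_mul_inv, le_div_iff₀ (by positivity), inv_mul_le_iff₀ hr]
      linarith
    calc _ ≤ D * (2 ^ a * (1 + r) ^ (-a)) * 2 ^ m := by gcongr
      _ = _ := by ring

/-! ### Weighted convolution estimates. -/

/-- Polar coordinates reduce this to `r^(N-1-b)` on `(0,1)`, whose exponent exceeds `-1`. -/
theorem integrable_indicator_norm_rpow {N : ℕ} (hN : 2 ≤ N) {b : ℝ} (hb : b < N) :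
    Integrable fun x : RN N => (Iio (1 : ℝ)).indicator (fun r => r ^ (-b)) ‖x‖ := by
  have : Nontrivial (RN N) :=
    Module.nontrivial_of_finrank_pos (R := ℝ) (by rw [finrank_euclideanSpace_fin]; omega)
  rw [integrable_fun_norm_addHaar]
  rw [finrank_euclideanSpace_fin]
  have h1 : IntegrableOn (fun r : ℝ => r ^ ((N : ℝ) - 1 - b)) (Ioo 0 1) :=
    (intervalIntegral.integrableOn_Ioo_rpow_iff one_pos).2 (by linarith)
  have h2 : IntegrableOn ((Iio (1 : ℝ)).indicator fun r : ℝ => r ^ ((N : ℝ) - 1 - b)) (Ioi 0) := by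
    rw [IntegrableOn, integrable_indicator_iff measurableSet_Iio, IntegrableOn,
      Measure.restrict_restrict measurableSet_Iio, Iio_inter_Ioi]
    exact h1
  refine h2.congr_fun (fun r hr => ?_) measurableSet_Ioi
  have hr : 0 < r := hr
  by_cases h : r < 1
  · rw [indicator_of_mem (show r ∈ Iio 1 from h), indicator_of_mem (show r ∈ Iio 1 from h),
      smul_eq_mul, ← Real.rpow_natCast, ← Real.rpow_add hr, Nat.cast_sub (by omega),
      Nat.cast_one, sub_eq_add_neg _ b]
  · have h' : r ∉ Iio 1 := h
    rw [indicator_of_notMem h', indicator_of_notMem h', smul_zero]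

/-- Replacing the larger base by the smaller one only increases a negative power. Used with `1 +
‖t‖` and `1 + ‖x - t‖`, this turns a product of two decays into a sum of two copies of one function,
without splitting the domain. -/
theorem rpow_neg_mul_rpow_neg_le {s t p q : ℝ} (hs : 0 < s) (ht : 0 < t) (hp : 0 ≤ p)
    (hq : 0 ≤ q) : s ^ (-p) * t ^ (-q) ≤ s ^ (-(p + q)) + t ^ (-(p + q)) := by
  have hadd : ∀ w : ℝ, 0 < w → w ^ (-(p + q)) = w ^ (-p) * w ^ (-q) := fun w hw => by
    rw [neg_add, Real.rpow_add hw]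
  rcases le_total s t with h | h
  · refine le_add_of_le_of_nonneg ?_ (by positivity)
    rw [hadd s hs]
    exact mul_le_mul_of_nonneg_left (Real.rpow_le_rpow_of_nonpos hs h (by linarith)) (by positivity)
  · refine le_add_of_nonneg_of_le (by positivity) ?_
    rw [hadd t ht]
    exact mul_le_mul_of_nonneg_right (Real.rpow_le_rpow_of_nonpos ht h (by linarith)) (by positivity)

/-- The integrals `∫ |Φ_k(t)| (1 + |x - t|)^{-β} dt` are bounded uniformly in `x`. -/
theorem helmholtzPhi_weighted_bound {N : ℕ} (hN : 2 ≤ N) {k : ℝ} (hk : 0 < k) {β : ℝ}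
    (hβ : ((N : ℝ) + 1) / 2 < β) :
    ∃ K : ℝ, 0 ≤ K ∧ ∀ x : RN N,
      Integrable (fun t : RN N => ‖helmholtzPhi k t‖ * (1 + ‖x - t‖) ^ (-β)) ∧
      ∫ t : RN N, ‖helmholtzPhi k t‖ * (1 + ‖x - t‖) ^ (-β) ≤ K := by
  have hN' : (2 : ℝ) ≤ N := by exact_mod_cast hN
  obtain ⟨C, b, hC, hb, h⟩ := helmholtzPhi_norm_le hN hk
  set a := ((N : ℝ) - 1) / 2 with ha
  set j : RN N → ℝ := fun t => (Iio (1 : ℝ)).indicator (fun r => r ^ (-b)) ‖t‖ with hj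
  -- The threshold `(N+1)/2` enters here: `a + β > (N-1)/2 + (N+1)/2 = N`, which makes `w`
  -- integrable.
  set w : RN N → ℝ := fun t => (1 + ‖t‖) ^ (-(a + β)) with hw
  have hji : Integrable j := integrable_indicator_norm_rpow hN hb
  have hwi : Integrable w := integrable_one_add_norm (by
    rw [finrank_euclideanSpace_fin]; linarith)
  have hj0 : ∀ t, 0 ≤ j t := fun t =>
    indicator_apply_nonneg fun _ => Real.rpow_nonneg (norm_nonneg t) _
  have hw0 : ∀ t, 0 ≤ w t := fun t => by simp only [hw]; positivity
  have hGi : ∀ x : RN N, Integrable fun t => C * (j t + (w t + w (x - t))) := fun x =>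
    (hji.add (hwi.add (hwi.comp_sub_left x))).const_mul C
  have hle : ∀ x : RN N, ∀ᵐ t : RN N, ‖helmholtzPhi k t‖ * (1 + ‖x - t‖) ^ (-β)
      ≤ C * (j t + (w t + w (x - t))) := by
    intro x
    have : Nontrivial (RN N) :=
      Module.nontrivial_of_finrank_pos (R := ℝ) (by rw [finrank_euclideanSpace_fin]; omega)
    filter_upwards [Measure.ae_ne volume (0 : RN N)] with t ht
    have h1 : (1 + ‖x - t‖) ^ (-β) ≤ 1 :=
      Real.rpow_le_one_of_one_le_of_nonpos (by linarith [norm_nonneg (x - t)]) (by linarith)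
    have h2 := rpow_neg_mul_rpow_neg_le (s := 1 + ‖t‖) (t := 1 + ‖x - t‖) (p := a) (q := β)
      (by positivity) (by positivity) (by rw [ha]; linarith) (by linarith)
    calc _ ≤ C * (j t + (1 + ‖t‖) ^ (-a)) * (1 + ‖x - t‖) ^ (-β) := by
          gcongr; exact h t ht
      _ = C * (j t * (1 + ‖x - t‖) ^ (-β) + (1 + ‖t‖) ^ (-a) * (1 + ‖x - t‖) ^ (-β)) := by ring
      _ ≤ _ := by
          gcongr
          exact mul_le_of_le_one_right (hj0 t) h1
  have hm := measurable_helmholtzPhi (N := N) k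
  refine ⟨C * ((∫ t, j t) + ((∫ t, w t) + ∫ t, w t)), ?_, fun x => ?_⟩
  · have : 0 ≤ ∫ t, j t := integral_nonneg hj0
    have : 0 ≤ ∫ t, w t := integral_nonneg hw0
    positivity
  have hint : Integrable (fun t : RN N => ‖helmholtzPhi k t‖ * (1 + ‖x - t‖) ^ (-β)) := by
    refine (hGi x).mono' (by fun_prop : Measurable _).aestronglyMeasurable ?_
    filter_upwards [hle x] with t ht
    rwa [Real.norm_of_nonneg (by positivity)]
  refine ⟨hint, (integral_mono_ae hint (hGi x) (hle x)).trans_eq ?_⟩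
  have hwx : Integrable fun t => w (x - t) := hwi.comp_sub_left x
  have hww : Integrable fun t => w t + w (x - t) := hwi.add hwx
  -- Reflection and translation invariance give `w (x - ·)` the same integral as `w`, so the bound
  -- does not depend on `x`.
  rw [integral_const_mul, integral_add hji hww, integral_add hwi hwx, integral_sub_left_eq_self]

/-- An essentially bounded function divided by the weight `(1 + |x|)^β` has an everywhere
absolutely convergent convolution with `Φ_k`, which is bounded and measurable. -/
theorem resolvent_weighted {N : ℕ} {k : ℝ} {β K : ℝ}
    (hK : ∀ x : RN N,
      Integrable (fun t : RN N => ‖helmholtzPhi k t‖ * (1 + ‖x - t‖) ^ (-β)) ∧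
      ∫ t : RN N, ‖helmholtzPhi k t‖ * (1 + ‖x - t‖) ^ (-β) ≤ K)
    {h : RN N → ℂ} (hm : AEStronglyMeasurable h) {C : ℝ} (hC : 0 ≤ C)
    (hb : ∀ᵐ x : RN N, ‖h x‖ ≤ C * (1 + ‖x‖) ^ (-β)) :
    ResolventDefined k h ∧ (∀ x, ‖helmholtzResolvent k h x‖ ≤ K * C) ∧
      AEStronglyMeasurable (helmholtzResolvent k h) := by
  have hΦ : AEStronglyMeasurable (helmholtzPhi k : RN N → ℂ) :=
    (measurable_helmholtzPhi k).aestronglyMeasurable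
  have hle : ∀ x : RN N, ∀ᵐ t : RN N,
      ‖ContinuousLinearMap.mul ℝ ℂ (helmholtzPhi k t) (h (x - t))‖
        ≤ C * (‖helmholtzPhi k t‖ * (1 + ‖x - t‖) ^ (-β)) := by
    intro x
    -- The almost-everywhere bound on `h` transfers to `t ↦ h (x - t)` because null sets pull back
    -- to null sets under `t ↦ x - t`.
    filter_upwards [(quasiMeasurePreserving_sub_left_of_right_invariant volume x).ae hb] with t ht
    rw [ContinuousLinearMap.mul_apply', norm_mul]
    calc _ ≤ ‖helmholtzPhi k t‖ * (C * (1 + ‖x - t‖) ^ (-β)) := by gcongr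
      _ = _ := by ring
  refine ⟨fun x => ?_, fun x => ?_, ?_⟩
  · exact ((hK x).1.const_mul C).mono' (hΦ.convolution_integrand_snd _ hm x) (hle x)
  · refine (norm_integral_le_of_norm_le ((hK x).1.const_mul C) (hle x)).trans ?_
    rw [integral_const_mul, mul_comm]
    exact mul_le_mul_of_nonneg_right (hK x).2 hC
  · exact (hΦ.convolution_integrand (ContinuousLinearMap.mul ℝ ℂ) hm).integral_prod_right'

/-! ### The weighted resolvent as an operator on `L^∞`. -/

theorem Lp_top_ae_norm_le {X E : Type*} [MeasurableSpace X] {μ : Measure X}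
    [NormedAddCommGroup E] (w : Lp E ⊤ μ) : ∀ᵐ x ∂μ, ‖w x‖ ≤ ‖w‖ := by
  have h := ae_le_eLpNormEssSup (f := w) (μ := μ)
  rw [← eLpNorm_exponent_top] at h
  filter_upwards [h] with x hx
  rw [Lp.norm_def, ← toReal_enorm]
  exact ENNReal.toReal_mono (Lp.eLpNorm_ne_top w) hx

theorem Lp_top_norm_le_of_ae_bound {X E : Type*} [MeasurableSpace X] {μ : Measure X}
    [NormedAddCommGroup E] (w : Lp E ⊤ μ) {C : ℝ} (hC : 0 ≤ C) (h : ∀ᵐ x ∂μ, ‖w x‖ ≤ C) :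
    ‖w‖ ≤ C := by
  rw [Lp.norm_def]
  refine ENNReal.toReal_le_of_le_ofReal hC ?_
  rw [eLpNorm_exponent_top]
  exact eLpNormEssSup_le_of_ae_bound h

/-- Division by the weight `(1 + |x|)^β`. -/
noncomputable def weightDiv {N : ℕ} (β : ℝ) (w : RN N → ℂ) : RN N → ℂ :=
  fun x => (1 + ‖x‖) ^ (-β) • w x

theorem weightDiv_aestronglyMeasurable {N : ℕ} (β : ℝ) (w : LInfty N) :
    AEStronglyMeasurable (weightDiv β w) := by
  have : Measurable fun x : RN N => (1 + ‖x‖) ^ (-β) := by fun_prop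
  exact this.aestronglyMeasurable.smul (Lp.aestronglyMeasurable w)

theorem weightDiv_norm_le {N : ℕ} (β : ℝ) (w : LInfty N) :
    ∀ᵐ x : RN N, ‖weightDiv β w x‖ ≤ ‖w‖ * (1 + ‖x‖) ^ (-β) := by
  filter_upwards [Lp_top_ae_norm_le w] with x hx
  rw [weightDiv, norm_smul, Real.norm_of_nonneg (by positivity), mul_comm]
  gcongr

/-- An integral ignores null sets, so equality holds at every point. Linearity on classes can thus
be checked on arbitrary representatives. -/
theorem helmholtzResolvent_congr {N : ℕ} (k : ℝ) {h h' : RN N → ℂ} (e : h =ᵐ[volume] h') :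
    helmholtzResolvent k h = helmholtzResolvent k h' :=
  convolution_congr _ EventuallyEq.rfl e

/-- The resolvent, precomposed with division by the weight, is a bounded operator on `L^∞`. -/
theorem exists_weighted_resolvent_clm {N : ℕ} (hN : 2 ≤ N) {k : ℝ} (hk : 0 < k) {β : ℝ}
    (hβ : ((N : ℝ) + 1) / 2 < β) :
    ∃ T : LInfty N →L[ℝ] LInfty N,
      ∀ w : LInfty N, T w =ᵐ[volume] helmholtzResolvent k (weightDiv β w) := by
  obtain ⟨K, hK0, hK⟩ := helmholtzPhi_weighted_bound hN hk hβ
  have hR := fun w : LInfty N => resolvent_weighted hK (weightDiv_aestronglyMeasurable β w)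
    (norm_nonneg w) (weightDiv_norm_le β w)
  have hL : ∀ w : LInfty N, MemLp (helmholtzResolvent k (weightDiv β w)) ⊤ := fun w =>
    memLp_top_of_bound (hR w).2.2 _ (Eventually.of_forall (hR w).2.1)
  have hadd : ∀ w w' : LInfty N, helmholtzResolvent k (weightDiv β (w + w' : LInfty N))
      = helmholtzResolvent k (weightDiv β w) + helmholtzResolvent k (weightDiv β w') := by
    intro w w'
    have e : weightDiv β (w + w' : LInfty N) =ᵐ[volume] weightDiv β w + weightDiv β w' := by
      filter_upwards [Lp.coeFn_add w w'] with x hx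
      simp only [weightDiv, hx, Pi.add_apply, smul_add]
    rw [helmholtzResolvent_congr k e]
    exact (hR w).1.distrib_add (hR w').1
  have hsmul : ∀ (c : ℝ) (w : LInfty N), helmholtzResolvent k (weightDiv β (c • w : LInfty N))
      = c • helmholtzResolvent k (weightDiv β w) := by
    intro c w
    have e : weightDiv β (c • w : LInfty N) =ᵐ[volume] c • weightDiv β w := by
      filter_upwards [Lp.coeFn_smul c w] with x hx
      simp only [weightDiv, hx, Pi.smul_apply]
      rw [smul_comm]
    rw [helmholtzResolvent_congr k e]
    exact convolution_smul
  refine ⟨LinearMap.mkContinuous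
    { toFun := fun w => (hL w).toLp _
      map_add' := fun w w' => ?_
      map_smul' := fun c w => ?_ } K fun w => ?_, fun w => MemLp.coeFn_toLp (hL w)⟩
  · rw [← MemLp.toLp_add]
    exact MemLp.toLp_congr _ _ (Eventually.of_forall fun x => congrFun (hadd w w') x)
  · rw [RingHom.id_apply, ← MemLp.toLp_const_smul]
    exact MemLp.toLp_congr _ _ (Eventually.of_forall fun x => congrFun (hsmul c w) x)
  · refine Lp_top_norm_le_of_ae_bound _ (by positivity) ?_
    filter_upwards [MemLp.coeFn_toLp (hL w)] with x hx
    exact (congrArg norm hx).trans_le ((hR w).2.1 x)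

/-! ### Substitution operators on `L^∞`. -/

/-- `g(x, ·)` is bounded on bounded sets, uniformly in `x`. -/
def LocallyBoundedUniformly {X E F : Type*} [Norm E] [Norm F] (g : X → E → F) : Prop :=
  ∀ M : ℝ, 0 < M → ∃ C : ℝ, ∀ x u, ‖u‖ ≤ M → ‖g x u‖ ≤ C

/-- `g(x, ·)` is uniformly continuous on bounded sets, uniformly in `x`. -/
def LocallyUniformlyContinuousUniformly {X E F : Type*} [NormedAddCommGroup E]
    [NormedAddCommGroup F] (g : X → E → F) : Prop :=
  ∀ M : ℝ, 0 < M → ∀ ε : ℝ, 0 < ε → ∃ δ : ℝ, 0 < δ ∧ ∀ x u v, ‖u‖ ≤ M → ‖v‖ ≤ M →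
    ‖u - v‖ ≤ δ → ‖g x u - g x v‖ ≤ ε

section Nemytskii

variable {X E F : Type*} [TopologicalSpace X] [MeasurableSpace X] [OpensMeasurableSpace X]
  [SecondCountableTopology X] [TopologicalSpace.PseudoMetrizableSpace X] {μ : Measure X}
  [NormedAddCommGroup E] [NormedAddCommGroup F]

theorem memLp_nemytskii {g : X → E → F} (hc : Continuous fun p : X × E => g p.1 p.2)
    (hb : LocallyBoundedUniformly g) (u : Lp E ⊤ μ) : MemLp (fun x => g x (u x)) ⊤ μ := by
  obtain ⟨C, hC⟩ := hb (‖u‖ + 1) (by positivity)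
  refine memLp_top_of_bound ?_ C ?_
  · have hid : AEStronglyMeasurable (fun x : X => x) μ :=
      aestronglyMeasurable_id
    exact hc.comp_aestronglyMeasurable (hid.prodMk (Lp.aestronglyMeasurable u))
  · filter_upwards [Lp_top_ae_norm_le u] with x hx
    exact hC x _ (by linarith)

/-- The substitution operator `u ↦ g(·, u(·))` on `L^∞`. -/
noncomputable def nemytskii (g : X → E → F) (hc : Continuous fun p : X × E => g p.1 p.2)
    (hb : LocallyBoundedUniformly g) (u : Lp E ⊤ μ) : Lp F ⊤ μ :=
  (memLp_nemytskii hc hb u).toLp _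

theorem coeFn_nemytskii {g : X → E → F} (hc : Continuous fun p : X × E => g p.1 p.2)
    (hb : LocallyBoundedUniformly g) (u : Lp E ⊤ μ) :
    nemytskii g hc hb u =ᵐ[μ] fun x => g x (u x) :=
  MemLp.coeFn_toLp _

/-- Closeness in `L^∞` is closeness of values at almost every point, so a modulus of continuity
uniform in `x` passes directly to the operator. -/
theorem continuous_nemytskii {g : X → E → F} (hc : Continuous fun p : X × E => g p.1 p.2)
    (hb : LocallyBoundedUniformly g) (hu : LocallyUniformlyContinuousUniformly g) :
    Continuous (nemytskii g hc hb : Lp E ⊤ μ → Lp F ⊤ μ) := by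
  rw [Metric.continuous_iff]
  intro u ε hε
  obtain ⟨δ, hδ, h⟩ := hu (‖u‖ + 1) (by positivity) (ε / 2) (by positivity)
  -- The bound `1` keeps `v` in the ball of radius `‖u‖ + 1` on which `δ` was chosen.
  refine ⟨min δ 1, by positivity, fun v hv => ?_⟩
  rw [dist_eq_norm] at hv ⊢
  have hvδ := hv.le.trans (min_le_left _ _)
  have hv1 := hv.le.trans (min_le_right _ _)
  have hvn : ‖v‖ ≤ ‖u‖ + 1 := by
    have := norm_le_norm_add_norm_sub' v u
    linarith
  refine lt_of_le_of_lt (Lp_top_norm_le_of_ae_bound _ (half_pos hε).le ?_) (half_lt_self hε)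
  filter_upwards [Lp.coeFn_sub (nemytskii g hc hb v) (nemytskii g hc hb u),
    coeFn_nemytskii hc hb v, coeFn_nemytskii hc hb u, Lp_top_ae_norm_le u, Lp_top_ae_norm_le v,
    Lp_top_ae_norm_le (v - u), Lp.coeFn_sub v u] with x h1 h2 h3 h4 h5 h6 h7
  rw [h1, Pi.sub_apply, h2, h3]
  rw [h7, Pi.sub_apply] at h6
  exact h x _ _ (by linarith) (by linarith) (by linarith)

variable [NormedSpace ℝ E] [NormedSpace ℝ F]

/-- The derivative is pointwise application of `g'(x, u(x))`, realised by the Hölder pairing `L^∞ ×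
L^∞ → L^∞`. The remainder is handled at each point by the mean value inequality, where the uniform
modulus of `g'` supplies an `ε` independent of `x`. -/
theorem hasFDerivAt_nemytskii {g : X → E → F}
    {g' : X → E → E →L[ℝ] F}
    (hc : Continuous fun p : X × E => g p.1 p.2) (hb : LocallyBoundedUniformly g)
    (hc' : Continuous fun p : X × E => g' p.1 p.2) (hb' : LocallyBoundedUniformly g')
    (hu' : LocallyUniformlyContinuousUniformly g')
    (hd : ∀ x u, HasFDerivAt (g x) (g' x u) u) (u : Lp E ⊤ μ) :
    HasFDerivAt (nemytskii g hc hb : Lp E ⊤ μ → Lp F ⊤ μ)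
      ((ContinuousLinearMap.id ℝ (E →L[ℝ] F)).holderL μ ⊤ ⊤ ⊤ (nemytskii g' hc' hb' u)) u := by
  rw [hasFDerivAt_iff_isLittleO, Asymptotics.isLittleO_iff]
  intro ε hε
  obtain ⟨δ, hδ, h⟩ := hu' (‖u‖ + 1) (by positivity) ε hε
  filter_upwards [Metric.closedBall_mem_nhds u (show 0 < min δ 1 by positivity)] with v hv
  rw [mem_closedBall_iff_norm] at hv
  have hvδ := hv.trans (min_le_left _ _)
  have hv1 := hv.trans (min_le_right _ _)
  refine Lp_top_norm_le_of_ae_bound _ (by positivity) ?_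
  rw [ContinuousLinearMap.holderL_apply_apply]
  filter_upwards [Lp.coeFn_sub (nemytskii g hc hb v - nemytskii g hc hb u)
      ((ContinuousLinearMap.id ℝ (E →L[ℝ] F)).holder ⊤ (nemytskii g' hc' hb' u) (v - u)),
    (ContinuousLinearMap.id ℝ (E →L[ℝ] F)).coeFn_holder (r := ⊤) (nemytskii g' hc' hb' u) (v - u),
    Lp.coeFn_sub (nemytskii g hc hb v) (nemytskii g hc hb u),
    coeFn_nemytskii hc hb v, coeFn_nemytskii hc hb u, coeFn_nemytskii hc' hb' u,
    Lp_top_ae_norm_le u, Lp_top_ae_norm_le (v - u), Lp.coeFn_sub v u]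
    with x h1 h2 h3 h4 h5 h6 h7 h8 h9
  rw [h1, Pi.sub_apply, h3, Pi.sub_apply, h2, h4, h5, h6]
  rw [h9, Pi.sub_apply] at h8 ⊢
  rw [ContinuousLinearMap.id_apply]
  -- The ball is convex and contains both `u x` and `v x`; the oscillation bound of `g'` on it is
  -- what the mean value inequality needs.
  have hseg : ∀ w ∈ Metric.closedBall (u x) ‖v x - u x‖, ‖g' x w - g' x (u x)‖ ≤ ε := by
    intro w hw
    rw [mem_closedBall_iff_norm] at hw
    have := norm_le_norm_add_norm_sub' w (u x)
    exact h x _ _ (by linarith) (by linarith) (by linarith)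
  refine ((convex_closedBall (u x) ‖v x - u x‖).norm_image_sub_le_of_norm_hasFDerivWithin_le'
    (fun w _ => (hd x w).hasFDerivWithinAt) hseg
    (Metric.mem_closedBall_self (norm_nonneg _)) (mem_closedBall_iff_norm.2 le_rfl)).trans ?_
  gcongr

/-- The derivative is a continuous linear map applied to the substitution operator of `g'`, so its
continuity is `continuous_nemytskii` for `g'`. -/
theorem contDiff_nemytskii {g : X → E → F}
    {g' : X → E → E →L[ℝ] F}
    (hc : Continuous fun p : X × E => g p.1 p.2) (hb : LocallyBoundedUniformly g)
    (hc' : Continuous fun p : X × E => g' p.1 p.2) (hb' : LocallyBoundedUniformly g')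
    (hu' : LocallyUniformlyContinuousUniformly g')
    (hd : ∀ x u, HasFDerivAt (g x) (g' x u) u) :
    ContDiff ℝ 1 (nemytskii g hc hb : Lp E ⊤ μ → Lp F ⊤ μ) :=
  contDiff_one_iff_hasFDerivAt.2
    ⟨_, (ContinuousLinearMap.continuous _).comp (continuous_nemytskii hc' hb' hu'),
      hasFDerivAt_nemytskii hc hb hc' hb' hu' hd⟩

end Nemytskii

/-! ### Weighted nonlinearities. -/

section Weight

theorem one_add_norm_le_japaneseBracket {N : ℕ} (x : RN N) :
    1 + ‖x‖ ≤ √2 * japaneseBracket x := by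
  rw [japaneseBracket, ← Real.sqrt_eq_rpow, ← Real.sqrt_mul (by norm_num)]
  refine Real.le_sqrt_of_sq_le ?_
  nlinarith [sq_nonneg (1 - ‖x‖)]

variable {N : ℕ} {F : Type*} [NormedAddCommGroup F]

theorem weight_bound_of_japaneseBracket {α : ℝ} (hα : 0 ≤ α) {h : RN N → ℂ → F}
    (hb : ∀ M : ℝ, 0 < M → ∃ C : ℝ, ∀ (x : RN N) (u : ℂ), ‖u‖ ≤ M →
      japaneseBracket x ^ α * ‖h x u‖ ≤ C) :
    ∀ M : ℝ, 0 < M → ∃ C : ℝ, ∀ (x : RN N) (u : ℂ), ‖u‖ ≤ M →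
      (1 + ‖x‖) ^ α * ‖h x u‖ ≤ C := by
  intro M hM
  obtain ⟨C, hC⟩ := hb M hM
  refine ⟨√2 ^ α * C, fun x u hu => ?_⟩
  have hj : 0 ≤ japaneseBracket x := by unfold japaneseBracket; positivity
  calc (1 + ‖x‖) ^ α * ‖h x u‖ ≤ (√2 * japaneseBracket x) ^ α * ‖h x u‖ := by
        gcongr
        exact one_add_norm_le_japaneseBracket x
    _ = √2 ^ α * (japaneseBracket x ^ α * ‖h x u‖) := by
        rw [Real.mul_rpow (by positivity) hj, mul_assoc]
    _ ≤ _ := by gcongr; exact hC x u hu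

variable [NormedSpace ℝ F]

/-- Multiplication by the weight `(1 + |x|)^β`. -/
noncomputable def weightMul (β : ℝ) (h : RN N → ℂ → F) (x : RN N) (u : ℂ) : F :=
  (1 + ‖x‖) ^ β • h x u

theorem continuous_weightMul (β : ℝ) {h : RN N → ℂ → F}
    (hc : Continuous fun p : RN N × ℂ => h p.1 p.2) :
    Continuous fun p : RN N × ℂ => weightMul β h p.1 p.2 := by
  refine Continuous.smul ?_ hc
  refine Continuous.rpow_const (by fun_prop) fun p => Or.inl ?_
  positivity

theorem locallyBoundedUniformly_weightMul {α β : ℝ} (hβ : β ≤ α) {h : RN N → ℂ → F}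
    (hb : ∀ M : ℝ, 0 < M → ∃ C : ℝ, ∀ (x : RN N) (u : ℂ), ‖u‖ ≤ M →
      (1 + ‖x‖) ^ α * ‖h x u‖ ≤ C) : LocallyBoundedUniformly (weightMul β h) := by
  intro M hM
  obtain ⟨C, hC⟩ := hb M hM
  refine ⟨C, fun x u hu => le_trans ?_ (hC x u hu)⟩
  rw [weightMul, norm_smul, Real.norm_of_nonneg (by positivity)]
  gcongr
  linarith [norm_nonneg x]

/-- Because `β < α` is strict, the weighted function is small for large `|x|`, uniformly for bounded
`u`, and the difference is trivially small there. The remaining `x` and `u` form a compact set,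
where Heine–Cantor applies. -/
theorem locallyUniformlyContinuousUniformly_weightMul {α β : ℝ} (hβ : β < α) {h : RN N → ℂ → F}
    (hc : Continuous fun p : RN N × ℂ => h p.1 p.2)
    (hb : ∀ M : ℝ, 0 < M → ∃ C : ℝ, ∀ (x : RN N) (u : ℂ), ‖u‖ ≤ M →
      (1 + ‖x‖) ^ α * ‖h x u‖ ≤ C) :
    LocallyUniformlyContinuousUniformly (weightMul β h) := by
  intro M hM ε hε
  obtain ⟨C, hC⟩ := hb M hM
  have hlim : Tendsto (fun r : ℝ => C * (1 + r) ^ (-(α - β))) atTop (𝓝 0) := by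
    have := ((tendsto_rpow_neg_atTop (sub_pos.2 hβ)).comp
      (tendsto_atTop_add_const_left atTop (1 : ℝ) tendsto_id)).const_mul C
    simpa [Function.comp_def] using this
  obtain ⟨R, hR⟩ := eventually_atTop.1 (hlim.eventually (gt_mem_nhds (half_pos hε)))
  have hfar : ∀ (x : RN N) (u : ℂ), R ≤ ‖x‖ → ‖u‖ ≤ M → ‖weightMul β h x u‖ ≤ ε / 2 := by
    intro x u hx hu
    refine le_trans ?_ (hR ‖x‖ hx).le
    rw [weightMul, norm_smul, Real.norm_of_nonneg (by positivity), neg_sub, sub_eq_add_neg,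
      Real.rpow_add (by positivity)]
    calc _ = (1 + ‖x‖) ^ α * ‖h x u‖ * ((1 + ‖x‖) ^ β * (1 + ‖x‖) ^ (-α)) := by
          have : (1 + ‖x‖) ^ α * (1 + ‖x‖) ^ (-α) = 1 := by
            rw [← Real.rpow_add (by positivity), add_neg_cancel, Real.rpow_zero]
          linear_combination (-(1 + ‖x‖) ^ β * ‖h x u‖) * this
      _ ≤ _ := by gcongr; exact hC x u hu
  have hcpt : IsCompact (Metric.closedBall (0 : RN N) R ×ˢ Metric.closedBall (0 : ℂ) M) :=
    (isCompact_closedBall _ _).prod (isCompact_closedBall _ _)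
  have huc := hcpt.uniformContinuousOn_of_continuous (continuous_weightMul β hc).continuousOn
  rw [Metric.uniformContinuousOn_iff_le] at huc
  obtain ⟨δ, hδ, hδ'⟩ := huc ε hε
  refine ⟨δ, hδ, fun x u v hu hv huv => ?_⟩
  rcases le_total R ‖x‖ with hx | hx
  · calc _ ≤ ‖weightMul β h x u‖ + ‖weightMul β h x v‖ := norm_sub_le _ _
      _ ≤ ε / 2 + ε / 2 := add_le_add (hfar x u hx hu) (hfar x v hx hv)
      _ = ε := add_halves ε
  · have := hδ' (x, u) (by simp [hx, hu]) (x, v) (by simp [hx, hv])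
      (by simpa [Prod.dist_eq, dist_eq_norm, hδ.le] using huv)
    rwa [dist_eq_norm] at this

end Weight

/-! ### The inverse function theorem for `u - R_k(N_f(u))`. -/

theorem theorem1p3 (N : ℕ) (hN : 2 ≤ N) (k : ℝ) (hk : 0 < k)
    (α : ℝ) (hα : ((N : ℝ) + 1) / 2 < α)
    (f : RN N → ℂ → ℂ)
    (hf_cont : Continuous fun p : RN N × ℂ => f p.1 p.2)
    (hf_bound : ∀ M : ℝ, 0 < M → ∃ C : ℝ, ∀ (x : RN N) (u : ℂ), ‖u‖ ≤ M →
      japaneseBracket x ^ α * ‖f x u‖ ≤ C)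
    (hf_diff : ∀ x : RN N, Differentiable ℝ (f x))
    (hf'_cont : Continuous fun p : RN N × ℂ => fderiv ℝ (f p.1) p.2)
    (hf'_bound : ∀ M : ℝ, 0 < M → ∃ C : ℝ, ∀ (x : RN N) (u : ℂ), ‖u‖ ≤ M →
      japaneseBracket x ^ α * ‖fderiv ℝ (f x) u‖ ≤ C)
    (hf_zero : ∀ x : RN N, f x 0 = 0)
    (hf'_zero : ∀ x : RN N, fderiv ℝ (f x) 0 = 0) :
    (∀ u : LInfty N, ResolventDefined k (substitutionOp f u) ∧
      MeasureTheory.MemLp (helmholtzResolvent k (substitutionOp f u)) ⊤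
        (MeasureTheory.volume : MeasureTheory.Measure (RN N))) ∧
    ∃ U V : Set (LInfty N), IsOpen U ∧ 0 ∈ U ∧ IsOpen V ∧ 0 ∈ V ∧
      (∀ φ ∈ V, ∃! u : LInfty N, u ∈ U ∧ SolvesHelmholtzEq k f φ u) ∧
      ∃ S : LInfty N → LInfty N,
        (∀ φ ∈ V, S φ ∈ U ∧ SolvesHelmholtzEq k f φ (S φ)) ∧ ContDiffOn ℝ 1 S V := by
  -- Decay of order `β` makes the convolution bounded; the surplus `α - β > 0` pays for uniform
  -- continuity of the weighted derivative.
  obtain ⟨β, hβ, hβα⟩ := exists_between hα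
  have hα0 : 0 ≤ α := le_trans (by positivity) hα.le
  have hb := weight_bound_of_japaneseBracket hα0 hf_bound
  have hb' := weight_bound_of_japaneseBracket hα0 hf'_bound
  have hgc := continuous_weightMul β hf_cont
  have hgb := locallyBoundedUniformly_weightMul hβα.le hb
  have hgc' := continuous_weightMul β (h := fun x u => fderiv ℝ (f x) u) hf'_cont
  have hgb' := locallyBoundedUniformly_weightMul hβα.le hb'
  have hgu' := locallyUniformlyContinuousUniformly_weightMul hβα
    (h := fun x u => fderiv ℝ (f x) u) hf'_cont hb'
  have hd : ∀ x u, HasFDerivAt (weightMul β f x)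
      (weightMul β (fun x u => fderiv ℝ (f x) u) x u) u := fun x u =>
    ((hf_diff x u).hasFDerivAt).const_smul ((1 + ‖x‖) ^ β)
  obtain ⟨T, hT⟩ := exists_weighted_resolvent_clm hN hk hβ
  set G : LInfty N → LInfty N := nemytskii (weightMul β f) hgc hgb with hG
  have hdiv : ∀ u : LInfty N, weightDiv β (G u) =ᵐ[volume] substitutionOp f u := by
    intro u
    filter_upwards [coeFn_nemytskii hgc hgb u] with x hx
    rw [weightDiv, hG, hx, weightMul, substitutionOp, smul_smul, ← Real.rpow_add (by positivity),
      neg_add_cancel, Real.rpow_zero, one_smul]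
  have hTG : ∀ u : LInfty N, T (G u) =ᵐ[volume] helmholtzResolvent k (substitutionOp f u) :=
    fun u => (hT (G u)).trans (helmholtzResolvent_congr k (hdiv u)).eventuallyEq
  refine ⟨fun u => ⟨?_, (memLp_congr_ae (hTG u)).1 (Lp.memLp _)⟩, ?_⟩
  · obtain ⟨K, -, hK⟩ := helmholtzPhi_weighted_bound (N := N) hN hk hβ
    refine (resolvent_weighted hK ((weightDiv_aestronglyMeasurable β (G u)).congr (hdiv u))
      (norm_nonneg (G u)) ?_).1
    filter_upwards [hdiv u, weightDiv_norm_le β (G u)] with x hx hx'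
    rwa [← hx]
  set P : LInfty N → LInfty N := fun u => u - T (G u) with hP
  have hsol : ∀ φ u : LInfty N, SolvesHelmholtzEq k f φ u ↔ P u = φ := by
    intro φ u
    rw [hP, sub_eq_iff_eq_add', Lp.ext_iff, SolvesHelmholtzEq]
    refine eventually_congr ?_
    filter_upwards [hTG u, Lp.coeFn_add (T (G u)) φ] with x hx hx'
    rw [hx', Pi.add_apply, hx]
  have hG1 : ContDiff ℝ 1 G := contDiff_nemytskii hgc hgb hgc' hgb' hgu' hd
  have hP1 : ContDiff ℝ 1 P := contDiff_id.sub (T.contDiff.comp hG1)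
  have h0 : ((0 : LInfty N) : RN N → ℂ) =ᵐ[volume] 0 := Lp.coeFn_zero _ _ _
  have hG0 : G 0 = 0 := by
    rw [Lp.ext_iff]
    filter_upwards [coeFn_nemytskii hgc hgb 0, h0] with x hx hx0
    rw [hG, hx, hx0, Pi.zero_apply, weightMul, hf_zero, smul_zero]
  have hP0 : P 0 = 0 := by simp [hP, hG0]
  have hG'0 : nemytskii (μ := volume) _ hgc' hgb' 0 = 0 := by
    rw [Lp.ext_iff]
    filter_upwards [coeFn_nemytskii (μ := volume) hgc' hgb' 0, h0,
      Lp.coeFn_zero (ℂ →L[ℝ] ℂ) ⊤ (volume : Measure (RN N))] with x hx hx0 hx1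
    rw [hx, hx0, hx1, Pi.zero_apply, Pi.zero_apply, weightMul, hf'_zero, smul_zero]
  -- The linear part of `T ∘ G` at zero vanishes by `hG'0`, so no inversion of an integral operator
  -- is needed.
  have hPd : HasFDerivAt P
      ((ContinuousLinearEquiv.refl ℝ (LInfty N) : LInfty N →L[ℝ] LInfty N)) 0 := by
    have h1 := hasFDerivAt_nemytskii (μ := volume) hgc hgb hgc' hgb' hgu' hd 0
    rw [hG'0, map_zero] at h1
    have h2 := (hasFDerivAt_id (𝕜 := ℝ) (0 : LInfty N)).sub (T.hasFDerivAt.comp 0 h1)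
    refine h2.congr_fderiv ?_
    ext1 v
    simp
  have hPa : ContDiffAt ℝ 1 P 0 := hP1.contDiffAt
  set e := hPa.toOpenPartialHomeomorph P hPd one_ne_zero with he
  have hes : (0 : LInfty N) ∈ e.source := hPa.mem_toOpenPartialHomeomorph_source hPd one_ne_zero
  have hee : ∀ u, e u = P u := fun _ => rfl
  have het : (0 : LInfty N) ∈ e.target := by
    have := e.map_source hes
    rwa [hee, hP0] at this
  have hSC : ContDiffAt ℝ 1 e.symm 0 := by
    have := hPa.to_localInverse hPd one_ne_zero
    rwa [hP0] at this
  -- The local inverse is so far known to be `C^1` only at zero. Being `C^1` at a point is an open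
  -- condition, so the interior is still a neighborhood of zero.
  set V := e.target ∩ interior {y | ContDiffAt ℝ 1 e.symm y} with hV
  have hVo : IsOpen V := e.open_target.inter isOpen_interior
  have hVm : ∀ φ ∈ V, e.symm φ ∈ e.source ∩ e ⁻¹' V ∧ SolvesHelmholtzEq k f φ (e.symm φ) := by
    intro φ hφ
    have h1 := e.right_inv hφ.1
    refine ⟨⟨e.map_target hφ.1, ?_⟩, (hsol _ _).2 h1⟩
    rwa [mem_preimage, h1]
  have h0V : (0 : LInfty N) ∈ V :=
    ⟨het, mem_interior_iff_mem_nhds.2 (hSC.eventually (by simp))⟩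
  -- This choice of `U` is exactly the image of `V` under `e.symm`; uniqueness then comes from the
  -- injectivity of `e` on its source.
  refine ⟨e.source ∩ e ⁻¹' V, V, e.isOpen_inter_preimage hVo, ⟨hes, ?_⟩, hVo, h0V, ?_,
    e.symm, hVm, fun φ hφ => ?_⟩
  · rwa [mem_preimage, hee, hP0]
  · refine fun φ hφ => ⟨e.symm φ, hVm φ hφ, fun u hu => ?_⟩
    rw [← (hsol _ _).1 hu.2, ← hee, e.left_inv hu.1.1]
  · have : ContDiffAt ℝ 1 e.symm φ := interior_subset hφ.2
    exact this.contDiffWithinAt
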